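/- All graphs are finite and simple. An instance of Maximum Independent Set (MIS) is a pair $(G,k)$ of a graph $G$ and $k\in\mathbb N$; it is a yes-instance, $\mathrm{yes}(G,k)$, if $G$ has an independent set of size $k$. Let $\alpha(G)$ be the independence number. "FPT time" means time at most $h(k)\cdot(|V(G)|+1)^{\gamma}$ for a computable function $h$ and a constant $\gamma$. Let $\mathcal C$ be a class of instances $(G,k)$ and let $g,d:\mathbb N\to\mathbb N$ be computable. A *witness* for $(G,k)$ is a partition of $V(G)$ into three sets $A,B,R$ such that $A,B\neq\emptyset$, $|R|<\min(|A|,|B|)$, $|R|\le g(k)$, $|A|,|B|>\lceil d(k)^{d(k)}k^{2d(k)-1}\rceil+1$, and the bipartite graph formed by the edges of $G$ between $A$ and $B$ does not contain $K_{d(k),d(k)}$ as a subgraph. The class $\mathcal C$ is *$(g,d)$-weakly connected* if every $(G,k)\in\mathcal C$ with $k\ge\alpha(G)$ has a witness. A *decreasing FPT $g'$-Turing-reduction* for MIS on $\mathcal C$ ($g'$ a computable function) is an FPT-time algorithm which, on input $(G,k)\in\mathcal C$, produces one after the other exactly $\ell=g'(k)$ instances $(G_1,k_1),\dots,(G_\ell,k_\ell)$;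 each of them is solved when it is produced (the algorithm receives an independent set of size $k_j$ of $G_j$, an arbitrary one, or is told that there is none), and later instances may depend on these answers. It is required that $|V(G_j)|\le|V(G)|$ and $k_j\le k-1$ for all $j$, and that $$\mathrm{yes}(G,k)\iff\varphi\bigl(\mathrm{yes}(G_1,k_1),\dots,\mathrm{yes}(G_\ell,k_\ell)\bigr),$$ where $\varphi$ is a fixed formula, which can be evaluated at $\ell$ Booleans in FPT time parameterized by $\ell$. **Theorem.** Let $\mathcal C$ be a $(g,d)$-weakly connected class of instances. Suppose that, for a computable function $h$ and a constant $\gamma$, some algorithm runs in time $h(k)\cdot(|V(G)|+1)^{\gamma}$ on the instances $(G,k)\in\mathcal C$ and outputs a witness whenever $k\ge\alpha(G)$. Then MIS admits a decreasing FPT $g'$-Turing-reduction on $\mathcal C$ for some computable $g'$, and all the instances it produces on input $(G,k)$ are of the form $(G_j,k_j)$ with $G_j$ an induced subgraph of $G$ and $k_j\le k-1$. In particular, if MIS can be decided in FPT time on the class of all instances $(H,k')$ with $H$ an induced subgraph of $G$ and $k'\le k-1$ for some $(G,k)\in\mathcal C$, then MIS can be decided in FPT time on $\mathcal C$. -/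

import Mathlib

noncomputable section

namespace MISReduction

/-! ### Graphs and instances of Maximum Independent Set -/

/-- A finite simple graph whose vertices are natural numbers. -/
structure FGraph where
  verts : Finset ℕ
  graph : SimpleGraph ℕ
  mem_of_adj : ∀ u v, graph.Adj u v → u ∈ verts

/-- The independence number `α(G)`. -/
def FGraph.alpha (G : FGraph) : ℕ :=
  (G.graph.induce (G.verts : Set ℕ)).indepNum

/-- `H` is an induced subgraph of `G`. -/
def FGraph.IsInducedSubgraph (H G : FGraph) : Prop :=
  H.verts ⊆ G.verts ∧
    ∀ u ∈ H.verts, ∀ v ∈ H.verts, (H.graph.Adj u v ↔ G.graph.Adj u v)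

/-- An instance `(G, k)` of Maximum Independent Set. -/
abbrev Inst : Type := FGraph × ℕ

/-- `S` is a solution of `(G, k)`: an independent set of `G` with exactly `k` vertices. -/
def IsSolution (I : Inst) (S : Finset ℕ) : Prop :=
  S ⊆ I.1.verts ∧ I.1.graph.IsNIndepSet I.2 S

/-- `(G, k)` is a positive instance. -/
def Yes (I : Inst) : Prop := ∃ S, IsSolution I S

/-! ### The machine model

Data are binary trees whose leaves carry natural numbers. Programs are built from constant-time
operations by pairing, composition, branching and while loops, with one unit of time for each
operation that is executed (a pure pointer machine: copying a datum copies a reference). Numbers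
can only be tested for equality, incremented and decremented. Besides, there is an instruction
`call` which consults an oracle. -/

/-- Data: binary trees with leaves in `ℕ`. -/
inductive Val : Type
  | num (n : ℕ) : Val
  | pair (a b : Val) : Val

namespace Val

def succ : Val → Val
  | num n => num (n + 1)
  | pair _ _ => num 0

def pred : Val → Val
  | num n => num (n - 1)
  | pair _ _ => num 0

def fst : Val → Val
  | num _ => num 0
  | pair a _ => a

def snd : Val → Val
  | num _ => num 0
  | pair _ b => b

/-- `1` on a pair, `0` on a number. -/
def isPair : Val → Val
  | num _ => num 0
  | pair _ _ => num 1

/-- Equality test for two numbers: `1` on a pair of equal numbers, `0` on everything else. -/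
def eqNum : Val → Val
  | pair (num m) (num n) => num (if m = n then 1 else 0)
  | _ => num 0

end Val

/-- Programs; each of them computes a partial map from data to data. -/
inductive Prog : Type
  | id : Prog
  | const (n : ℕ) : Prog
  | succ : Prog
  | pred : Prog
  | fst : Prog
  | snd : Prog
  | isPair : Prog
  | eqNum : Prog
  | pair (f g : Prog) : Prog
  | comp (f g : Prog) : Prog
  | ite (c f g : Prog) : Prog
  | while (c f : Prog) : Prog
  | call : Prog

/-- `Eval ω p v w t l`: with oracle `ω`, the program `p` halts on input `v` with output `w` after
`t` steps, and `l` is the list of the questions asked to the oracle, in chronological order.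
A test succeeds if its value is not the number `0`. -/
inductive Eval (ω : Val → Val) : Prog → Val → Val → ℕ → List Val → Prop
  | id (v) : Eval ω Prog.id v v 1 []
  | const (n v) : Eval ω (Prog.const n) v (Val.num n) 1 []
  | succ (v) : Eval ω Prog.succ v v.succ 1 []
  | pred (v) : Eval ω Prog.pred v v.pred 1 []
  | fst (v) : Eval ω Prog.fst v v.fst 1 []
  | snd (v) : Eval ω Prog.snd v v.snd 1 []
  | isPair (v) : Eval ω Prog.isPair v v.isPair 1 []
  | eqNum (v) : Eval ω Prog.eqNum v v.eqNum 1 []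
  | pair {f g v a b s t l m} (hf : Eval ω f v a s l) (hg : Eval ω g v b t m) :
      Eval ω (Prog.pair f g) v (Val.pair a b) (s + t + 1) (l ++ m)
  | comp {f g v a b s t l m} (hg : Eval ω g v a s l) (hf : Eval ω f a b t m) :
      Eval ω (Prog.comp f g) v b (s + t + 1) (l ++ m)
  | ite_true {c f g v a b s t l m} (hc : Eval ω c v a s l) (ha : a ≠ Val.num 0)
      (hf : Eval ω f v b t m) : Eval ω (Prog.ite c f g) v b (s + t + 1) (l ++ m)
  | ite_false {c f g v b s t l m} (hc : Eval ω c v (Val.num 0) s l)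
      (hg : Eval ω g v b t m) : Eval ω (Prog.ite c f g) v b (s + t + 1) (l ++ m)
  | while_true {c f v a b w s t u l m n} (hc : Eval ω c v a s l) (ha : a ≠ Val.num 0)
      (hf : Eval ω f v b t m) (hw : Eval ω (Prog.while c f) b w u n) :
      Eval ω (Prog.while c f) v w (s + t + u + 1) (l ++ m ++ n)
  | while_false {c f v s l} (hc : Eval ω c v (Val.num 0) s l) :
      Eval ω (Prog.while c f) v v (s + 1) l
  | call (v) : Eval ω Prog.call v (ω v) 1 [v]

/-- The program `p` halts on `v` with output `w` after `t` steps, without using any oracle. -/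
def Computes (p : Prog) (v w : Val) (t : ℕ) : Prop :=
  ∀ ω, Eval ω p v w t []

/-! ### Encodings -/

def encList : List Val → Val
  | [] => Val.num 0
  | a :: l => Val.pair a (encList l)

/-- A finite set of numbers is encoded by its increasing list. -/
def encFinset (S : Finset ℕ) : Val := encList ((S.sort (· ≤ ·)).map Val.num)

def encBool (b : Bool) : Val := Val.num b.toNat

open Classical in
/-- A graph is encoded by its adjacency lists: the list of the pairs `(v, N(v))`, `v` a vertex. -/
def encGraph (G : FGraph) : Val :=
  encList ((G.verts.sort (· ≤ ·)).map fun v =>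
    Val.pair (Val.num v) (encFinset {u ∈ G.verts | G.graph.Adj v u}))

def encInst (I : Inst) : Val := Val.pair (encGraph I.1) (Val.num I.2)

def encTriple (A B R : Finset ℕ) : Val :=
  Val.pair (encFinset A) (Val.pair (encFinset B) (encFinset R))

/-! ### FPT algorithms and decreasing FPT Turing-reductions -/

/-- The running time `h(k) · (n + 1)^γ`, for `n` vertices and parameter `k`
(`n + 1` instead of `n` only matters for the graph without vertices). -/
def fptTime (h : ℕ → ℕ) (γ n k : ℕ) : ℕ := h k * (n + 1) ^ γ

open Classical in
/-- Maximum Independent Set can be decided in FPT time on the instances in `𝓒`. -/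
def SolvableInFPTTime (𝓒 : Set Inst) : Prop :=
  ∃ (p : Prog) (h : ℕ → ℕ) (γ : ℕ), Computable h ∧
    ∀ I ∈ 𝓒, ∃ t ≤ fptTime h γ I.1.verts.card I.2,
      Computes p (encInst I) (encBool (decide (Yes I))) t

/-- The formula `φ` can be evaluated at `ℓ` Booleans in FPT time parameterized by `ℓ`. -/
def FPTCheckable (φ : List Bool → Bool) : Prop :=
  ∃ (p : Prog) (h : ℕ → ℕ) (γ : ℕ), Computable h ∧
    ∀ bs : List Bool, ∃ t ≤ fptTime h γ bs.length bs.length,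
      Computes p (encList (bs.map encBool)) (encBool (φ bs)) t

/-- The oracle `ω` solves all instances of Maximum Independent Set: asked for `(G, k)`, it answers
`(1, S)` with some solution `S`, or `0` if there is no solution. -/
def SolvesMIS (ω : Val → Val) : Prop :=
  ∀ I : Inst,
    (∃ S, IsSolution I S ∧ ω (encInst I) = Val.pair (Val.num 1) (encFinset S)) ∨
      (¬ Yes I ∧ ω (encInst I) = Val.num 0)

/-- With oracle `ω`, the program `p` halts on the instance `I` after `t` steps, and the instances
that it produced (and had solved by the oracle) are those in the list `Js`. -/
def Produces (ω : Val → Val) (p : Prog) (I : Inst) (Js : List Inst) (t : ℕ) : Prop :=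
  ∃ w, Eval ω p (encInst I) w t (Js.map encInst)

open Classical in
/-- `p` is a decreasing FPT `g`-Turing-reduction for Maximum Independent Set on `𝓒`. -/
def IsDecreasingFPTTuringReduction (𝓒 : Set Inst) (g : ℕ → ℕ) (p : Prog) : Prop :=
  Computable g ∧
  ∃ (φ : List Bool → Bool) (h : ℕ → ℕ) (γ : ℕ), FPTCheckable φ ∧ Computable h ∧
    ∀ I ∈ 𝓒, ∀ ω, SolvesMIS ω →
      ∃ (Js : List Inst) (t : ℕ), Produces ω p I Js t ∧
        t ≤ fptTime h γ I.1.verts.card I.2 ∧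
        Js.length = g I.2 ∧
        (Yes I ↔ φ (Js.map fun J => decide (Yes J)) = true) ∧
        (∀ J ∈ Js, J.1.verts.card ≤ I.1.verts.card) ∧
        (∀ J ∈ Js, J.2 < I.2)

/-- On the instances in `𝓒`, all instances produced by `p` live on induced subgraphs of the
input graph. -/
def ProducesInducedSubgraphs (𝓒 : Set Inst) (p : Prog) : Prop :=
  ∀ I ∈ 𝓒, ∀ ω, SolvesMIS ω →
    ∃ (Js : List Inst) (t : ℕ), Produces ω p I Js t ∧ ∀ J ∈ Js, J.1.IsInducedSubgraph I.1

/-- The instances `(H, k')` with `k' < k` and `H` an induced subgraph of `G`, for `(G, k)` in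
`𝓒`. -/
def smallerInstances (𝓒 : Set Inst) : Set Inst :=
  {J | ∃ I ∈ 𝓒, J.1.IsInducedSubgraph I.1 ∧ J.2 < I.2}

/-! ### Weakly connected classes -/

/-- `(A, B, R)` is a non-trivial tripartition of the vertices of `G`. -/
structure IsNontrivialTripartition (G : FGraph) (A B R : Finset ℕ) : Prop where
  disjoint_AB : Disjoint A B
  disjoint_AR : Disjoint A R
  disjoint_BR : Disjoint B R
  union_eq : A ∪ B ∪ R = G.verts
  nonempty_A : A.Nonempty
  nonempty_B : B.Nonempty
  card_R_lt : R.card < min A.card B.card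

/-- `(A, B, R)` is a witness of `(g, d)`-weak connectedness of `G` for the parameter `k`.
The last condition forces `d k ≥ 1`, as `K_{0,0}` is contained in every graph; hence the
subtraction is the usual one, and the lower bound on the sizes needs no rounding. -/
structure IsWitness (g d : ℕ → ℕ) (G : FGraph) (k : ℕ) (A B R : Finset ℕ) : Prop where
  tripartition : IsNontrivialTripartition G A B R
  card_R_le : R.card ≤ g k
  lt_card_A : d k ^ d k * k ^ (2 * d k - 1) + 1 < A.card
  lt_card_B : d k ^ d k * k ^ (2 * d k - 1) + 1 < B.card
  biclique_free :
    (completeBipartiteGraph (Fin (d k)) (Fin (d k))).Free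
      (G.graph.between (A : Set ℕ) (B : Set ℕ))

/-- The instances in `𝓒` are `(g, d)`-weakly connected. -/
def WeaklyConnected (g d : ℕ → ℕ) (𝓒 : Set Inst) : Prop :=
  Computable g ∧ Computable d ∧
    ∀ I ∈ 𝓒, I.1.alpha ≤ I.2 → ∃ A B R, IsWitness g d I.1 I.2 A B R

/-- The program `p` runs in time `h(k) · (n + 1)^γ` on the instances `(G, k)` in `𝓒`, and finds a
witness of weak connectedness whenever `k ≥ α(G)`. -/
def FindsWitness (g d : ℕ → ℕ) (𝓒 : Set Inst) (p : Prog) (h : ℕ → ℕ) (γ : ℕ) : Prop :=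
  ∀ I ∈ 𝓒, ∃ w, ∃ t ≤ fptTime h γ I.1.verts.card I.2,
    Computes p (encInst I) w t ∧
      (I.1.alpha ≤ I.2 → ∃ A B R, IsWitness g d I.1 I.2 A B R ∧ w = encTriple A B R)

end MISReduction

end

/-! Let (A, B, R) be a witness for (G, k), and let P exceed g(k) and a Ramsey-type bound in k and
d(k). For each split k = i + j with i, j ≥ 1, independent sets of size i in A and of size j in B are
extracted greedily, up to P disjoint ones on each side. Each costs one question, with parameter i or
j, hence below k.

Suppose both sides yield P sets and (G, k) is negative. Then every extracted set in A is joined by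
an edge to every extracted set in B. The positions of the ends of such an edge colour the pairs with
i·j colours, and two applications of the pigeonhole principle give a K_{d,d} between A and B
(`exists_biclique`, `yes_of_hasFamily`), a contradiction. A side of size 1 counts as successful
without regard to the search, since the lower bounds on |A| and |B| supply enough singletons
(`IsWitness.yes`).

If no split succeeds on both sides, then for each split one side, of size other than 1, ends with a
maximal disjoint family, whose vertices meet all independent sets of that size on that side
(`Run.fam`). Let L consist of all extracted vertices and of R; its length is bounded in terms of k.
Every solution meets L: if it avoids R, it splits over A and B, and a solution inside one side is
treated by a split with a part 1, which cannot be the failing side. So (G, k) is positive iff (G -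
N[v], k - 1) is for some v in L (`yes_iff_of_search`).

A witness is only promised for k ≥ α(G). Otherwise the instance is positive, so a positive verdict
is never wrong, while the argument that a solution meets L needs only that A, B, R cover the
vertices. This is enforced by intersecting the output of the given algorithm with the vertex set and
recomputing R.

The number of questions must depend on k alone, so all loops run a fixed number of rounds and pad
with superfluous questions. The last question is a trivial instance whose answer is the verdict of
the program; thus φ is simply the last answer.

What remains is programming with time bounds. Thresholds are computed through primitive recursion
and unbounded search (`exists_prog_of_computable`). The final assertion on decidability does not
pass through the reduction: with a decision procedure for the smaller instances, one can afford to
branch over all vertices (`solvableInFPTTime_of_smallerInstances`). -/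

noncomputable section

namespace MISReduction

/-! ### Verified runs -/

/-- With oracle `ω`, the program `p` maps `v` to `w` in time at most `T`, asking `m` questions,
all of which are instances with the property `Q`. -/
def Run (ω : Val → Val) (Q : Inst → Prop) (p : Prog) (v w : Val) (T m : ℕ) : Prop :=
  ∃ (t : ℕ) (Js : List Inst), t ≤ T ∧ Js.length = m ∧ (∀ J ∈ Js, Q J) ∧
    Eval ω p v w t (Js.map encInst)

/-- The entry number `i` of an environment. -/
def nth : ℕ → Val → Val
  | 0, v => v.fst
  | i + 1, v => nth i v.snd

/-- Access to the entry number `i` of the environment. -/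
def Prog.get : ℕ → Prog
  | 0 => Prog.fst
  | i + 1 => Prog.comp (Prog.get i) Prog.snd

/-- Evaluates `e`, pushes the result onto the environment, and continues with `f`. -/
def Prog.letp (e f : Prog) : Prog := Prog.comp f (Prog.pair e Prog.id)

/-- The entries of a datum that is read as a list. -/
def Val.toList : Val → List Val
  | num _ => []
  | pair a b => a :: b.toList

@[simp] theorem toList_encList (l : List Val) : (encList l).toList = l := by
  induction l with
  | nil => rfl
  | cons a l ih => simp [encList, Val.toList, ih]

namespace Run

variable {ω : Val → Val} {Q : Inst → Prop}

theorem mono {p v w T m T'} (h : Run ω Q p v w T m) (hT : T ≤ T') : Run ω Q p v w T' m := by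
  obtain ⟨t, Js, ht, h⟩ := h
  exact ⟨t, Js, ht.trans hT, h⟩

theorem cast {p v w T m w' T' m'} (h : Run ω Q p v w T m) (hw : w = w') (hT : T ≤ T')
    (hm : m = m') : Run ω Q p v w' T' m' := by
  subst hw hm
  exact h.mono hT

theorem of_eval {p v w t T} (h : Eval ω p v w t []) (ht : t ≤ T) : Run ω Q p v w T 0 :=
  ⟨t, [], ht, rfl, by simp, h⟩

theorem id (v) : Run ω Q Prog.id v v 1 0 := of_eval (.id v) le_rfl
theorem const (n v) : Run ω Q (Prog.const n) v (Val.num n) 1 0 := of_eval (.const n v) le_rfl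
theorem fst (v) : Run ω Q Prog.fst v v.fst 1 0 := of_eval (.fst v) le_rfl
theorem snd (v) : Run ω Q Prog.snd v v.snd 1 0 := of_eval (.snd v) le_rfl
theorem succ (v) : Run ω Q Prog.succ v v.succ 1 0 := of_eval (.succ v) le_rfl
theorem pred (v) : Run ω Q Prog.pred v v.pred 1 0 := of_eval (.pred v) le_rfl
theorem isPair (v) : Run ω Q Prog.isPair v v.isPair 1 0 := of_eval (.isPair v) le_rfl
theorem eqNum (v) : Run ω Q Prog.eqNum v v.eqNum 1 0 := of_eval (.eqNum v) le_rfl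

theorem pair {f g v a b T T' m m'} (hf : Run ω Q f v a T m) (hg : Run ω Q g v b T' m') :
    Run ω Q (Prog.pair f g) v (Val.pair a b) (T + T' + 1) (m + m') := by
  obtain ⟨t, Js, ht, rfl, hQ, h⟩ := hf
  obtain ⟨t', Js', ht', rfl, hQ', h'⟩ := hg
  refine ⟨t + t' + 1, Js ++ Js', by omega, by simp, ?_, ?_⟩
  · intro J hJ
    exact (List.mem_append.1 hJ).elim (hQ J) (hQ' J)
  · rw [List.map_append]
    exact .pair h h'

theorem comp {f g v a b T T' m m'} (hg : Run ω Q g v a T m) (hf : Run ω Q f a b T' m') :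
    Run ω Q (Prog.comp f g) v b (T + T' + 1) (m + m') := by
  obtain ⟨t, Js, ht, rfl, hQ, h⟩ := hg
  obtain ⟨t', Js', ht', rfl, hQ', h'⟩ := hf
  refine ⟨t + t' + 1, Js ++ Js', by omega, by simp, ?_, ?_⟩
  · intro J hJ
    exact (List.mem_append.1 hJ).elim (hQ J) (hQ' J)
  · rw [List.map_append]
    exact .comp h h'

theorem ite_true {c f g v a b T T' m m'} (hc : Run ω Q c v a T m) (ha : a ≠ Val.num 0)
    (hf : Run ω Q f v b T' m') : Run ω Q (Prog.ite c f g) v b (T + T' + 1) (m + m') := by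
  obtain ⟨t, Js, ht, rfl, hQ, h⟩ := hc
  obtain ⟨t', Js', ht', rfl, hQ', h'⟩ := hf
  refine ⟨t + t' + 1, Js ++ Js', by omega, by simp, ?_, ?_⟩
  · intro J hJ
    exact (List.mem_append.1 hJ).elim (hQ J) (hQ' J)
  · rw [List.map_append]
    exact .ite_true h ha h'

theorem ite_false {c f g v b T T' m m'} (hc : Run ω Q c v (Val.num 0) T m)
    (hf : Run ω Q g v b T' m') : Run ω Q (Prog.ite c f g) v b (T + T' + 1) (m + m') := by
  obtain ⟨t, Js, ht, rfl, hQ, h⟩ := hc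
  obtain ⟨t', Js', ht', rfl, hQ', h'⟩ := hf
  refine ⟨t + t' + 1, Js ++ Js', by omega, by simp, ?_, ?_⟩
  · intro J hJ
    exact (List.mem_append.1 hJ).elim (hQ J) (hQ' J)
  · rw [List.map_append]
    exact .ite_false h h'

/-- Branching on a Boolean. -/
theorem ite {b : Bool} {c f g v w₁ w₂ T T₁ T₂ m m'}
    (hc : Run ω Q c v (encBool b) T m) (hf : b = true → Run ω Q f v w₁ T₁ m')
    (hg : b = false → Run ω Q g v w₂ T₂ m') :
    Run ω Q (Prog.ite c f g) v (if b then w₁ else w₂) (T + (T₁ + T₂) + 1) (m + m') := by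
  cases b
  · exact (ite_false hc (hg rfl)).mono (by omega)
  · exact (ite_true hc (by simp [encBool]) (hf rfl)).mono (by omega)

theorem while_true {c f v a b w T T' U m m' n} (hc : Run ω Q c v a T m) (ha : a ≠ Val.num 0)
    (hf : Run ω Q f v b T' m') (hw : Run ω Q (Prog.while c f) b w U n) :
    Run ω Q (Prog.while c f) v w (T + T' + U + 1) (m + m' + n) := by
  obtain ⟨t, Js, ht, rfl, hQ, h⟩ := hc
  obtain ⟨t', Js', ht', rfl, hQ', h'⟩ := hf
  obtain ⟨t'', Js'', ht'', rfl, hQ'', h''⟩ := hw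
  refine ⟨t + t' + t'' + 1, Js ++ Js' ++ Js'', by omega, by simp; omega, ?_, ?_⟩
  · intro J hJ
    simp only [List.mem_append] at hJ
    exact hJ.elim (fun h => h.elim (hQ J) (hQ' J)) (hQ'' J)
  · rw [List.map_append, List.map_append]
    exact .while_true h ha h' h''

theorem while_false {c f v T m} (hc : Run ω Q c v (Val.num 0) T m) :
    Run ω Q (Prog.while c f) v v (T + 1) m := by
  obtain ⟨t, Js, ht, rfl, hQ, h⟩ := hc
  exact ⟨t + 1, Js, by omega, rfl, hQ, .while_false h⟩

theorem call {J : Inst} (hJ : Q J) : Run ω Q Prog.call (encInst J) (ω (encInst J)) 1 1 :=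
  ⟨1, [J], le_rfl, rfl, by simpa using hJ, .call _⟩

theorem get (i : ℕ) (v) : Run ω Q (Prog.get i) v (nth i v) (2 * i + 1) 0 := by
  induction i generalizing v with
  | zero => exact fst v
  | succ i ih => exact ((snd v).comp (ih v.snd)).mono (by omega)

theorem letp {e f v a b T T' m m'} (he : Run ω Q e v a T m)
    (hf : Run ω Q f (Val.pair a v) b T' m') :
    Run ω Q (Prog.letp e f) v b (T + T' + 3) (m + m') :=
  ((he.pair (id v)).comp hf).mono (by omega)

theorem of_computes {p v w t T} (h : Computes p v w t) (ht : t ≤ T) : Run ω Q p v w T 0 :=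
  of_eval (h ω) ht

end Run

/-- The oracle enters only through `call`, which always leaves a question in the list. So a single
run without questions, under any oracle, already gives `Computes`. -/
theorem Eval.of_no_questions {ω ω' : Val → Val} {p v w t l} (h : Eval ω p v w t l) (hl : l = []) :
    Eval ω' p v w t [] := by
  induction h with
  | id => exact .id _
  | const => exact .const _ _
  | succ => exact .succ _
  | pred => exact .pred _
  | fst => exact .fst _
  | snd => exact .snd _
  | isPair => exact .isPair _
  | eqNum => exact .eqNum _
  | pair _ _ ih₁ ih₂ =>
    rw [List.append_eq_nil_iff] at hl
    exact .pair (ih₁ hl.1) (ih₂ hl.2)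
  | comp _ _ ih₁ ih₂ =>
    rw [List.append_eq_nil_iff] at hl
    exact .comp (ih₁ hl.1) (ih₂ hl.2)
  | ite_true _ ha _ ih₁ ih₂ =>
    rw [List.append_eq_nil_iff] at hl
    exact .ite_true (ih₁ hl.1) ha (ih₂ hl.2)
  | ite_false _ _ ih₁ ih₂ =>
    rw [List.append_eq_nil_iff] at hl
    exact .ite_false (ih₁ hl.1) (ih₂ hl.2)
  | while_true _ ha _ _ ih₁ ih₂ ih₃ =>
    rw [List.append_eq_nil_iff, List.append_eq_nil_iff] at hl
    exact .while_true (ih₁ hl.1.1) ha (ih₂ hl.1.2) (ih₃ hl.2)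
  | while_false _ ih => exact .while_false (ih hl)
  | call => simp at hl

theorem Run.computes {ω Q p v w T} (h : Run ω Q p v w T 0) : ∃ t ≤ T, Computes p v w t := by
  obtain ⟨t, Js, ht, hm, -, h⟩ := h
  rw [List.length_eq_zero_iff.1 hm] at h
  exact ⟨t, ht, fun ω' => h.of_no_questions rfl⟩

/-! ### The size of outputs -/

def Val.depth : Val → ℕ
  | num _ => 0
  | pair a b => max a.depth b.depth + 1

theorem length_toList_le_depth (v : Val) : v.toList.length ≤ v.depth := by
  induction v with
  | num => simp [Val.toList]
  | pair a b _ ih => simp only [Val.toList, List.length_cons, Val.depth]; omega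

theorem depth_fst_le (v : Val) : v.fst.depth ≤ v.depth := by
  cases v <;> simp only [Val.fst, Val.depth] <;> omega

theorem depth_snd_le (v : Val) : v.snd.depth ≤ v.depth := by
  cases v <;> simp only [Val.snd, Val.depth] <;> omega

/-- Sharing lets the size of a datum double in one step, but its depth grows by at most one per unit
of time, and depth bounds the length of a list. This controls the lists returned by the witness
finder, which are arbitrary if `k < α(G)`. The constant oracle keeps `call` from returning deep
data. -/
theorem Eval.depth_le {p v w t l} (h : Eval (fun _ => Val.num 0) p v w t l) :
    w.depth ≤ v.depth + t := by
  induction h with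
  | fst v => exact (depth_fst_le v).trans (by omega)
  | snd v => exact (depth_snd_le v).trans (by omega)
  | succ v => cases v <;> simp [Val.succ, Val.depth]
  | pred v => cases v <;> simp [Val.pred, Val.depth]
  | isPair v => cases v <;> simp [Val.isPair, Val.depth]
  | eqNum v => unfold Val.eqNum; split <;> simp [Val.depth]
  | pair => simp only [Val.depth]; omega
  | _ => first | omega | simp [Val.depth]

theorem Computes.depth_le {p v w t} (h : Computes p v w t) : w.depth ≤ v.depth + t :=
  (h _).depth_le

/-! ### Loops over lists and numbers -/

/-- On input `(L, (b, ρ))`: the loop which runs through the list `L` and updates `b` by running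
`body` on `(x, (b, ρ))` for each entry `x`. -/
def Prog.fold (body : Prog) : Prog :=
  .comp (.get 1) (.while (.comp .isPair .fst)
    (.pair (.comp .snd .fst)
      (.pair (.comp body (.pair (.comp .fst .fst) .snd)) (.comp .snd .snd))))

/-- On input `(n, (b, ρ))`: the loop which updates `b` by running `body` on `(i, (b, ρ))`, for
`i = n, …, 1`. -/
def Prog.iter (body : Prog) : Prog :=
  .comp (.get 1) (.while .fst (.pair (.comp .pred .fst) (.pair body (.comp .snd .snd))))

variable {ω : Val → Val} {Q : Inst → Prop}

theorem Run.fold {β : Type*} (enc : β → Val) (step : β → Val → β) {body ρ T m} (L : Val)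
    (h : ∀ x ∈ L.toList, ∀ b,
      Run ω Q body (.pair x (.pair (enc b) ρ)) (enc (step b x)) T m) (b : β) :
    Run ω Q (.fold body) (.pair L (.pair (enc b) ρ)) (enc (L.toList.foldl step b))
      (L.toList.length * (T + 18) + 8) (L.toList.length * m) := by
  -- The loop stops at whatever number terminates the list, so the final remainder `L'` is left
  -- unspecified.
  suffices ∃ L', Run ω Q (.while (.comp .isPair .fst) (.pair (.comp .snd .fst)
      (.pair (.comp body (.pair (.comp .fst .fst) .snd)) (.comp .snd .snd))))
      (.pair L (.pair (enc b) ρ)) (.pair L' (.pair (enc (L.toList.foldl step b)) ρ))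
      (L.toList.length * (T + 18) + 4) (L.toList.length * m) by
    obtain ⟨L', hr⟩ := this
    exact (hr.comp (Run.get 1 _)).cast rfl (by omega) (by omega)
  induction L generalizing b with
  | num n =>
    exact ⟨.num n, (Run.while_false ((Run.fst _).comp (Run.isPair _))).cast rfl (by simp)
      (by simp [Val.toList])⟩
  | pair x L _ ih =>
    obtain ⟨L', hr⟩ := ih (fun y hy => h y (by simp [Val.toList, hy])) (step b x)
    have hc : Run ω Q (.comp .isPair .fst) (.pair (.pair x L) (.pair (enc b) ρ)) (.num 1) 3 0 :=
      (Run.fst _).comp (Run.isPair _)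
    have hb := (((Run.fst (ω := ω) (Q := Q) (.pair (.pair x L) (.pair (enc b) ρ))).comp
      (Run.snd _)).pair (((((Run.fst _).comp (Run.fst _)).pair (Run.snd _)).comp
        (h x (by simp [Val.toList]) b)).pair ((Run.snd _).comp (Run.snd _))))
    refine ⟨L', (Run.while_true hc (by simp) hb hr).cast rfl ?_ ?_⟩
    · simp only [Val.toList, List.length_cons, Nat.add_mul]; omega
    · simp only [Val.toList, List.length_cons, Nat.add_mul]; omega

/-- The invariant is a relation, indexed by the remaining rounds, because the next state may depend
on an oracle answer of which only correctness is known. All rounds ask equally many questions, which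
makes the total exact. -/
theorem Run.iter (Inv : ℕ → Val → Prop) {body ρ T m} (n : ℕ)
    (h : ∀ i < n, ∀ v, Inv (i + 1) v → ∃ w, Inv i w ∧
      Run ω Q body (.pair (.num (i + 1)) (.pair v ρ)) w T m) (v : Val) (hv : Inv n v) :
    ∃ w, Inv 0 w ∧ Run ω Q (.iter body) (.pair (.num n) (.pair v ρ)) w
      (n * (T + 12) + 8) (n * m) := by
  suffices ∃ w, Inv 0 w ∧ Run ω Q (.while .fst (.pair (.comp .pred .fst) (.pair body
      (.comp .snd .snd)))) (.pair (.num n) (.pair v ρ)) (.pair (.num 0) (.pair w ρ))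
      (n * (T + 12) + 4) (n * m) by
    obtain ⟨w, hw, hr⟩ := this
    exact ⟨w, hw, (hr.comp (Run.get 1 _)).cast rfl (by omega) (by omega)⟩
  induction n generalizing v with
  | zero => exact ⟨v, hv, (Run.while_false (Run.fst _)).cast rfl (by omega) (by omega)⟩
  | succ n ih =>
    obtain ⟨w, hw, hr⟩ := h n (by omega) v hv
    obtain ⟨w', hw', hr'⟩ := ih (fun i hi => h i (by omega)) w hw
    refine ⟨w', hw', (Run.while_true (Run.fst _) (by simp [Val.fst])
      (((Run.fst _).comp (Run.pred _)).pair (hr.pair ((Run.snd _).comp (Run.snd _)))) hr').cast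
      rfl ?_ ?_⟩
    · simp only [Nat.add_mul]; omega
    · simp only [Nat.add_mul]; omega

/-! ### Programs for lists -/

@[simp] theorem eqNum_pair_num (x : Val) (a : ℕ) :
    (Val.pair (.num a) x).eqNum = encBool (@decide (x = .num a) (Classical.dec _)) := by
  cases x with
  | num b => by_cases h : a = b <;> simp [Val.eqNum, encBool, h, eq_comm]
  | pair => simp [Val.eqNum, encBool]

open Classical in
theorem Run.eqNum_pair_num (x : Val) (a : ℕ) :
    Run ω Q .eqNum (.pair (.num a) x) (encBool (decide (x = .num a))) 1 0 :=
  (Run.eqNum _).cast (MISReduction.eqNum_pair_num x a) le_rfl rfl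

/-- On input `(L, M)`: the reversal of the list `L`, followed by `M`. -/
def Prog.revOnto : Prog :=
  .comp (.fold (.pair (.get 0) (.get 1))) (.pair .fst (.pair .snd .id))

theorem Run.revOnto (L : Val) (l : List Val) :
    Run ω Q .revOnto (.pair L (encList l)) (encList (L.toList.reverse ++ l))
      (L.toList.length * 23 + 14) 0 := by
  have h := Run.fold (ω := ω) (Q := Q) encList (fun l x => x :: l) (ρ := .pair L (encList l)) L
    (fun x _ b => (Run.get 0 _).pair (Run.get 1 _)) l
  refine (((Run.fst _).pair ((Run.snd _).pair (Run.id _))).comp h).cast ?_ (by omega) (by omega)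
  congr 1
  clear h
  generalize L.toList = xs
  induction xs generalizing l with
  | nil => rfl
  | cons x xs ih => rw [List.foldl_cons, ih]; simp

/-- On input `(L, ρ)`: the list of the values of `e` on the entries of the list `L` on which the
test `c` succeeds. Both programs are run on inputs `(x, (y, ρ))`, `x` an entry of `L`. -/
def Prog.collect (c e : Prog) : Prog :=
  .comp (.fold (.ite c (.pair e (.get 1)) (.get 1)))
    (.pair (.comp .revOnto (.pair .fst (.const 0))) (.pair (.const 0) .snd))

/-- The loop prepends its results, so the list is reversed beforehand: the order has to survive, as
sets are encoded by increasing lists. -/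
theorem Run.collect {c e : Prog} {L ρ : Val} {T T'} (p : Val → Bool) (g : Val → Val)
    (hc : ∀ x ∈ L.toList, ∀ y, Run ω Q c (.pair x (.pair y ρ)) (encBool (p x)) T 0)
    (he : ∀ x ∈ L.toList, ∀ y, Run ω Q e (.pair x (.pair y ρ)) (g x) T' 0) :
    Run ω Q (.collect c e) (.pair L ρ) (encList ((L.toList.filter p).map g))
      (L.toList.length * (T + T' + 50) + 40) 0 := by
  have hrev : Run ω Q (.comp .revOnto (.pair .fst (.const 0))) (.pair L ρ)
      (encList L.toList.reverse) (L.toList.length * 23 + 18) 0 :=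
    (((Run.fst _).pair (Run.const 0 _)).comp (Run.revOnto L [])).cast (by simp) (by omega)
      (by omega)
  have h := Run.fold (ω := ω) (Q := Q) encList (fun l x => if p x then g x :: l else l) (ρ := ρ)
    (encList L.toList.reverse) (T := T + T' + 9) (m := 0)
    (body := .ite c (.pair e (.get 1)) (.get 1)) ?_ []
  · refine ((hrev.pair ((Run.const 0 _).pair (Run.snd _))).comp h).cast ?_ ?_ (by omega)
    · congr 1
      rw [toList_encList, List.foldl_reverse]
      generalize L.toList = xs
      induction xs with
      | nil => rfl
      | cons x xs ih => rw [List.foldr_cons, ih, List.filter_cons]; split <;> simp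
    · rw [toList_encList, List.length_reverse]
      simp only [Nat.mul_add]
      omega
  · intro x hx b
    have hx' : x ∈ L.toList := by simpa using hx
    refine ((hc x hx' _).ite (fun _ => (he x hx' _).pair (Run.get 1 _))
      (fun _ => (Run.get 1 _).mono (T' := 3) (by omega))).cast ?_ (by omega) (by omega)
    split <;> rfl

open Classical in
/-- Membership of a number in a list of arbitrary data. -/
def memVal (a : ℕ) (L : Val) : Bool := decide (Val.num a ∈ L.toList)

theorem memVal_iff {a : ℕ} {L : Val} : memVal a L = true ↔ Val.num a ∈ L.toList := by
  simp [memVal]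

def memTime (n : ℕ) : ℕ := n * 40 + 20

/-- On input `(a, L)`: is the number `a` an entry of the list `L`? -/
def Prog.mem : Prog :=
  .comp (.fold (.ite (.comp .eqNum (.pair (.get 2) (.get 0))) (.const 1) (.get 1)))
    (.pair .snd (.pair (.const 0) .id))

open Classical in
theorem Run.mem (a : ℕ) (L : Val) {n : ℕ} (hn : L.toList.length ≤ n) :
    Run ω Q .mem (.pair (.num a) L) (encBool (memVal a L)) (memTime n) 0 := by
  have h := Run.fold (ω := ω) (Q := Q) encBool (fun b x => if x = .num a then true else b)
    (ρ := .pair (.num a) L) L (T := 18) (m := 0)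
    (body := .ite (.comp .eqNum (.pair (.get 2) (.get 0))) (.const 1) (.get 1)) ?_ false
  · refine (((Run.snd _).pair ((Run.const 0 _).pair (Run.id _))).comp h).cast ?_ ?_ (by omega)
    · congr 1
      clear h hn
      suffices ∀ b, L.toList.foldl (fun b x => if x = .num a then true else b) b =
          (b || memVal a L) by simpa using this false
      unfold memVal
      generalize L.toList = xs
      intro b
      induction xs generalizing b with
      | nil => simp
      | cons x xs ih =>
        rw [List.foldl_cons, ih]
        by_cases hx : x = .num a
        · simp [hx]
        · simp [hx, Ne.symm hx]
    · have := Nat.mul_le_mul_right 40 hn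
      unfold memTime
      omega
  · intro x _ b
    have hc : Run ω Q (.comp .eqNum (.pair (.get 2) (.get 0)))
        (.pair x (.pair (encBool b) (.pair (.num a) L))) _ _ _ :=
      ((Run.get 2 _).pair (Run.get 0 _)).comp (Run.eqNum_pair_num x a)
    refine (hc.ite
      (fun _ => Run.const 1 _) (fun _ => Run.get 1 _)).cast ?_ (by omega) (by omega)
    by_cases hx : x = .num a <;> simp [hx, encBool, nth, Val.snd, Val.fst]

/-- Negation. -/
def Prog.not : Prog := .ite .id (.const 0) (.const 1)

theorem Run.not (b : Bool) : Run ω Q .not (encBool b) (encBool !b) 4 0 := by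
  refine ((Run.id _).ite (fun _ => Run.const 0 _) (fun _ => Run.const 1 _)).cast ?_ (by omega)
    (by omega)
  cases b <;> rfl

/-- The encoding of a list of numbers. -/
def numList (l : List ℕ) : Val := encList (l.map Val.num)

@[simp] theorem toList_numList (l : List ℕ) : (numList l).toList = l.map Val.num :=
  toList_encList _

@[simp] theorem memVal_numList {a : ℕ} {l : List ℕ} : memVal a (numList l) = true ↔ a ∈ l := by
  simp [memVal_iff]

theorem encFinset_eq (S : Finset ℕ) : encFinset S = numList (S.sort (· ≤ ·)) := rfl

@[simp] theorem memVal_encFinset {a : ℕ} {S : Finset ℕ} :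
    memVal a (encFinset S) = true ↔ a ∈ S := by
  simp [encFinset_eq]

theorem length_toList_encFinset (S : Finset ℕ) : (encFinset S).toList.length = S.card := by
  simp [encFinset_eq]

/-- On input `(L, M)`: the entries of the list `L` of numbers which belong to `M`. -/
def Prog.inter : Prog :=
  .collect (.comp .mem (.pair (.get 0) (.comp .snd .snd))) (.get 0)

/-- On input `(L, M)`: the entries of the list `L` of numbers which do not belong to `M`. -/
def Prog.diff : Prog :=
  .collect (.comp .not (.comp .mem (.pair (.get 0) (.comp .snd .snd)))) (.get 0)

def filterTime (n N : ℕ) : ℕ := n * (memTime N + 80) + 40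

theorem map_filter_num (l : List ℕ) (f : ℕ → Bool) (p : Val → Bool)
    (hp : ∀ a, p (.num a) = f a) :
    ((l.map Val.num).filter p).map (fun x => x) = (l.filter f).map Val.num := by
  rw [List.map_id', List.filter_map]
  congr 2
  exact funext hp

theorem Run.inter (l : List ℕ) (M : Val) {n N : ℕ} (hn : l.length ≤ n)
    (hN : M.toList.length ≤ N) :
    Run ω Q .inter (.pair (numList l) M) (numList (l.filter fun a => memVal a M))
      (filterTime n N) 0 := by
  refine (Run.collect (fun x => match x with | .num a => memVal a M | _ => false) (fun x => x)
    (T := memTime N + 10) (T' := 1) ?_ (fun x _ y => Run.get 0 _)).cast ?_ ?_ rfl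
  · intro x hx y
    obtain ⟨a, -, rfl⟩ := List.mem_map.1 (toList_numList l ▸ hx)
    exact (((Run.get 0 _).pair ((Run.snd _).comp (Run.snd _))).comp (Run.mem a M hN)).cast rfl
      (by omega) (by omega)
  · rw [toList_numList, map_filter_num l (fun a => memVal a M) _ (fun _ => rfl)]
    rfl
  · rw [toList_numList, List.length_map]
    exact Nat.add_le_add_right (Nat.mul_le_mul hn (by omega)) _

theorem Run.diff (l : List ℕ) (M : Val) {n N : ℕ} (hn : l.length ≤ n)
    (hN : M.toList.length ≤ N) :
    Run ω Q .diff (.pair (numList l) M) (numList (l.filter fun a => !memVal a M))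
      (filterTime n N) 0 := by
  refine (Run.collect (fun x => match x with | .num a => !memVal a M | _ => false) (fun x => x)
    (T := memTime N + 15) (T' := 1) ?_ (fun x _ y => Run.get 0 _)).cast ?_ ?_ rfl
  · intro x hx y
    obtain ⟨a, -, rfl⟩ := List.mem_map.1 (toList_numList l ▸ hx)
    exact ((((Run.get 0 _).pair ((Run.snd _).comp (Run.snd _))).comp (Run.mem a M hN)).comp
      (Run.not _)).cast rfl (by omega) (by omega)
  · rw [toList_numList, map_filter_num l (fun a => !memVal a M) _ (fun _ => rfl)]
    rfl
  · rw [toList_numList, List.length_map]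
    exact Nat.add_le_add_right (Nat.mul_le_mul hn (by omega)) _

/-! ### Programs for graphs -/

/-- The subgraph of `G` induced by the vertices in `S`. -/
def FGraph.restrict (G : FGraph) (S : Finset ℕ) : FGraph where
  verts := G.verts ∩ S
  graph :=
    { Adj := fun u v => G.graph.Adj u v ∧ u ∈ S ∧ v ∈ S
      symm := ⟨fun _ _ h => ⟨h.1.symm, h.2.2, h.2.1⟩⟩
      loopless := ⟨fun _ h => h.1.ne rfl⟩ }
  mem_of_adj u v h := Finset.mem_inter.2 ⟨G.mem_of_adj u v h.1, h.2.1⟩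

theorem FGraph.restrict_isInducedSubgraph (G : FGraph) (S : Finset ℕ) :
    (G.restrict S).IsInducedSubgraph G :=
  ⟨Finset.inter_subset_left, fun _ hu _ hv =>
    ⟨fun h => h.1, fun h => ⟨h, (Finset.mem_inter.1 hu).2, (Finset.mem_inter.1 hv).2⟩⟩⟩

/-- Filtering keeps an increasing list increasing, and a set has only one such list. So the
filtering programs output canonical encodings, which is indispensable for questions: the oracle is
constrained only on data of the form `encInst J`. -/
theorem sort_filter (S : Finset ℕ) (p : ℕ → Bool) :
    (S.filter fun a => p a = true).sort (· ≤ ·) = (S.sort (· ≤ ·)).filter p := by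
  refine List.Perm.eq_of_pairwise (le := (· ≤ ·)) (fun a b _ _ => le_antisymm)
    (Finset.pairwise_sort _ _) ((Finset.pairwise_sort _ _).filter _) ?_
  refine (List.perm_ext_iff_of_nodup (Finset.sort_nodup _ _)
    ((Finset.sort_nodup _ _).filter _)).2 fun a => ?_
  simp

/-- On input of a graph: the list of its vertices. -/
def Prog.verts : Prog :=
  .comp (.collect (.const 1) (.comp .fst (.get 0))) (.pair .id .id)

theorem Run.verts (G : FGraph) {n : ℕ} (hn : G.verts.card ≤ n) :
    Run ω Q .verts (encGraph G) (encFinset G.verts) (n * 60 + 50) 0 := by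
  have h := Run.collect (ω := ω) (Q := Q) (L := encGraph G) (ρ := encGraph G) (T := 1) (T' := 3)
    (c := .const 1) (e := .comp .fst (.get 0))
    (fun _ => true) (fun x => x.fst) (fun _ _ _ => Run.const 1 _)
    (fun _ _ _ => (Run.get 0 _).comp (Run.fst _))
  refine (((Run.id _).pair (Run.id _)).comp h).cast ?_ ?_ (by omega)
  · simp only [encGraph, toList_encList, encFinset, List.filter_true, List.map_map]
    rfl
  · simp only [encGraph, toList_encList, List.length_map, Finset.length_sort]
    omega

/-- On input `(G, U)`: the subgraph of `G` induced by the vertices in the list `U`. -/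
def Prog.induce : Prog :=
  .collect (.comp .mem (.pair (.comp .fst (.get 0)) (.comp .snd .snd)))
    (.pair (.comp .fst (.get 0)) (.comp .inter (.pair (.comp .snd (.get 0)) (.comp .snd .snd))))

def induceTime (n N : ℕ) : ℕ := n * (memTime N + filterTime n N + 100) + 40

open Classical in
theorem Run.induce (G : FGraph) (U : Val) (S : Finset ℕ) (hU : ∀ a, memVal a U = true ↔ a ∈ S)
    {n N : ℕ} (hn : G.verts.card ≤ n) (hN : U.toList.length ≤ N) :
    Run ω Q .induce (.pair (encGraph G) U) (encGraph (G.restrict S)) (induceTime n N) 0 := by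
  have hmem : ∀ x ∈ (encGraph G).toList, ∃ v, x = Val.pair (.num v)
      (encFinset {u ∈ G.verts | G.graph.Adj v u}) := by
    intro x hx
    rw [encGraph, toList_encList] at hx
    obtain ⟨a, -, rfl⟩ := List.mem_map.1 hx
    exact ⟨a, rfl⟩
  have hf : ∀ s : Finset ℕ, (s.sort (· ≤ ·)).filter (fun a => memVal a U) =
      (s.filter fun a => memVal a U = true).sort (· ≤ ·) := fun s => (sort_filter s _).symm
  refine (Run.collect
    (fun x => match x with | .pair (.num a) _ => memVal a U | _ => false)
    (fun x => match x with
      | .pair (.num a) _ => .pair (.num a) (encFinset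
        {u ∈ G.verts | G.graph.Adj a u ∧ memVal u U = true})
      | _ => .num 0)
    (T := memTime N + 15) (T' := filterTime n N + 20) ?_ ?_).cast ?_ ?_ rfl
  · intro x hx y
    obtain ⟨v, rfl⟩ := hmem x hx
    exact ((((Run.get 0 _).comp (Run.fst _)).pair ((Run.snd _).comp (Run.snd _))).comp
      (Run.mem v U hN)).cast rfl (by omega) (by omega)
  · intro x hx y
    obtain ⟨v, rfl⟩ := hmem x hx
    refine (((Run.get 0 _).comp (Run.fst _)).pair ((((Run.get 0 _).comp (Run.snd _)).pair
      ((Run.snd _).comp (Run.snd _))).comp (Run.inter _ U (n := n) ?_ hN))).cast ?_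
      (by omega) (by omega)
    · rw [Finset.length_sort]
      exact (Finset.card_filter_le _ _).trans hn
    · simp only [hf, Finset.filter_filter, encFinset_eq]
      rfl
  · simp only [encGraph, toList_encList, List.filter_map, List.map_map]
    congr 1
    have : G.verts ∩ S = G.verts.filter fun a => memVal a U = true := by
      ext a
      simp [hU]
    rw [show (G.restrict S).verts = G.verts ∩ S from rfl, this, sort_filter]
    refine List.map_congr_left fun v hv => ?_
    have hv' : memVal v U = true := by simpa using (List.mem_filter.1 hv).2
    simp only [Function.comp]
    congr 2
    ext u
    simp only [Finset.mem_filter, FGraph.restrict, ← hU]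
    tauto
  · simp only [encGraph, toList_encList, List.length_map, Finset.length_sort]
    exact Nat.add_le_add_right (Nat.mul_le_mul hn (by omega)) _

/-- On input `(G, v)`: the list of the vertices outside of the closed neighbourhood of `v`. -/
def Prog.nonNbrs : Prog :=
  .collect (.ite (.comp .eqNum (.pair (.comp .snd .snd) (.comp .fst (.get 0)))) (.const 0)
      (.comp .not (.comp .mem (.pair (.comp .snd .snd) (.comp .snd (.get 0))))))
    (.comp .fst (.get 0))

open Classical in
/-- The vertices of `G` outside of the closed neighbourhood of `v`. -/
def FGraph.nonNbrs (G : FGraph) (v : ℕ) : Finset ℕ :=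
  {u ∈ G.verts | u ≠ v ∧ ¬G.graph.Adj v u}

def nonNbrsTime (n : ℕ) : ℕ := n * (memTime n + 120) + 40

open Classical in
theorem Run.nonNbrs (G : FGraph) (v : ℕ) (hv : v ∈ G.verts) {n : ℕ} (hn : G.verts.card ≤ n) :
    Run ω Q .nonNbrs (.pair (encGraph G) (.num v)) (encFinset (G.nonNbrs v)) (nonNbrsTime n) 0 := by
  have hmem : ∀ x ∈ (encGraph G).toList, ∃ v, x = Val.pair (.num v)
      (encFinset {u ∈ G.verts | G.graph.Adj v u}) := by
    intro x hx
    rw [encGraph, toList_encList] at hx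
    obtain ⟨a, -, rfl⟩ := List.mem_map.1 hx
    exact ⟨a, rfl⟩
  refine (Run.collect
    (fun x => match x with
      | .pair (.num a) N => !decide (a = v) && !memVal v N
      | _ => false)
    (fun x => x.fst) (T := memTime n + 40) (T' := 3) ?_ ?_).cast ?_ ?_ rfl
  · intro x hx y
    obtain ⟨a, rfl⟩ := hmem x hx
    have hlen : (encFinset {u ∈ G.verts | G.graph.Adj a u}).toList.length ≤ n :=
      (length_toList_encFinset _).trans_le ((Finset.card_filter_le _ _).trans hn)
    have hc : Run ω Q (.comp .eqNum (.pair (.comp .snd .snd) (.comp .fst (.get 0))))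
        (.pair (.pair (.num a) (encFinset {u ∈ G.verts | G.graph.Adj a u})) (.pair y (.num v)))
        _ _ _ :=
      (((Run.snd _).comp (Run.snd _)).pair ((Run.get 0 _).comp (Run.fst _))).comp
        (Run.eqNum_pair_num (.num a) v)
    have hm : Run ω Q (.comp .mem (.pair (.comp .snd .snd) (.comp .snd (.get 0))))
        (.pair (.pair (.num a) (encFinset {u ∈ G.verts | G.graph.Adj a u})) (.pair y (.num v)))
        _ _ _ :=
      (((Run.snd _).comp (Run.snd _)).pair ((Run.get 0 _).comp (Run.snd _))).comp
        (Run.mem v _ hlen)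
    refine (hc.ite (fun _ => Run.const 0 _) (fun _ => hm.comp (Run.not _))).cast ?_ ?_ (by omega)
    · by_cases h : a = v <;> simp [h, nth, Val.fst, Val.snd, encBool]
    · omega
  · intro x hx y
    exact ((Run.get 0 _).comp (Run.fst _))
  · simp only [encGraph, toList_encList, List.filter_map, List.map_map, encFinset]
    congr 1
    have : G.nonNbrs v = G.verts.filter fun a => (!decide (a = v) && !memVal v
        (encFinset {u ∈ G.verts | G.graph.Adj a u})) = true := by
      ext a
      simp only [FGraph.nonNbrs, Finset.mem_filter, Bool.and_eq_true, Bool.not_eq_true',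
        ← Bool.not_eq_true, memVal_encFinset, G.graph.adj_comm a v, decide_eq_true_eq]
      tauto
    rw [this, sort_filter]
    rfl
  · simp only [encGraph, toList_encList, List.length_map, Finset.length_sort]
    exact Nat.add_le_add_right (Nat.mul_le_mul hn (by omega)) _

/-! ### Programs for computable functions -/

/-- The program `p` computes the function `f` of several numbers in time `T`. -/
def ComputesVec {n : ℕ} (p : Prog) (f T : List.Vector ℕ n → ℕ) : Prop :=
  ∀ ω Q v, Run ω Q p (numList v.toList) (.num (f v)) (T v) 0

theorem nth_numList (l : List ℕ) (i : ℕ) (hi : i < l.length) : nth i (numList l) = .num l[i] := by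
  induction l generalizing i with
  | nil => simp at hi
  | cons a l ih =>
    cases i with
    | zero => rfl
    | succ i => exact ih i (by simpa using hi)

theorem exists_prog_ofFn {n m : ℕ} (g : Fin m → List.Vector ℕ n → ℕ)
    (h : ∀ i, ∃ p T, Primrec T ∧ ComputesVec p (g i) T) :
    ∃ (p : Prog) (T : List.Vector ℕ n → ℕ), Primrec T ∧ ∀ ω Q v,
      Run ω Q p (numList v.toList) (numList (List.ofFn fun i => g i v)) (T v) 0 := by
  induction m with
  | zero => exact ⟨.const 0, fun _ => 1, .const 1, fun ω Q v => by
      rw [List.ofFn_zero]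
      exact Run.const 0 _⟩
  | succ m ih =>
    obtain ⟨p, T, hT, hp⟩ := ih (fun i => g i.succ) (fun i => h i.succ)
    obtain ⟨p', T', hT', hp'⟩ := h 0
    refine ⟨.pair p' p, fun v => T' v + T v + 1,
      Primrec.nat_add.comp (Primrec.nat_add.comp hT' hT) (.const 1), fun ω Q v => ?_⟩
    rw [List.ofFn_succ]
    exact (hp' ω Q v).pair (hp ω Q v)

theorem primrec_sum_range {α : Type*} [Primcodable α] {f : α → ℕ → ℕ} (hf : Primrec₂ f) :
    Primrec₂ fun a n => ∑ i ∈ Finset.range n, f a i := by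
  refine (Primrec.nat_rec (f := fun _ : α => 0) (g := fun a p => p.2 + f a p.1) (.const 0)
    (Primrec.nat_add.comp (Primrec.snd.comp .snd)
      (hf.comp .fst (Primrec.fst.comp .snd)))).of_eq fun a n => ?_
  induction n with
  | zero => rfl
  | succ n ih => rw [Finset.sum_range_succ, ← ih]

/-- Induction on the construction of `f`. The time bound is required to be primitive recursive as
well, since under composition and recursion it is evaluated at values of other functions and summed.
-/
theorem exists_prog_of_primrec' {n : ℕ} {f : List.Vector ℕ n → ℕ} (hf : Nat.Primrec' f) :
    ∃ p T, Primrec T ∧ ComputesVec p f T := by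
  induction hf with
  | zero => exact ⟨.const 0, fun _ => 1, .const 1, fun ω Q v => Run.const 0 _⟩
  | succ =>
    refine ⟨.comp .succ .fst, fun _ => 3, .const 3, fun ω Q v => ?_⟩
    obtain ⟨l, hl⟩ := v
    obtain ⟨a, rfl⟩ := List.length_eq_one_iff.1 hl
    exact (Run.fst _).comp (Run.succ _)
  | get i =>
    refine ⟨.get i, fun _ => 2 * i + 1, .const _, fun ω Q v => ?_⟩
    refine (Run.get i _).cast ?_ le_rfl rfl
    rw [nth_numList _ _ (by simp)]
    rfl
  | comp g _ _ ihf ihg =>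
    obtain ⟨p, T, hT, hp⟩ := ihf
    obtain ⟨p', T', hT', hp'⟩ := exists_prog_ofFn g ihg
    refine ⟨.comp p p', fun v => T' v + T (.ofFn fun i => g i v) + 1,
      Primrec.nat_add.comp (Primrec.nat_add.comp hT' (hT.comp (.vector_ofFn fun i => ?_)))
        (.const 1), fun ω Q v => ?_⟩
    · exact (‹∀ i, Nat.Primrec' (g i)› i).to_prim
    · have := hp ω Q (.ofFn fun i => g i v)
      rw [List.Vector.toList_ofFn] at this
      exact (hp' ω Q v).comp this
  | @prec n f g hf hg ihf ihg =>
    obtain ⟨p, T, hT, hp⟩ := ihf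
    obtain ⟨q, U, hU, hq⟩ := ihg
    let F : ℕ → List.Vector ℕ n → ℕ := fun m v => m.rec (f v) fun y IH => g (y ::ᵥ IH ::ᵥ v)
    have hF : Primrec₂ fun (v : List.Vector ℕ n) m => F m v :=
      Primrec.nat_rec (g := fun v p => g (p.1 ::ᵥ p.2 ::ᵥ v)) hf.to_prim
        (hg.to_prim.comp (Primrec.vector_cons.comp (Primrec.fst.comp .snd)
          (Primrec.vector_cons.comp (Primrec.snd.comp .snd) .fst)))
    -- All rounds of the loop need a common time bound; the sum over the rounds is one, and it is
    -- visibly primitive recursive.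
    let S : List.Vector ℕ n → ℕ → ℕ := fun v m =>
      ∑ y ∈ Finset.range m, U (y ::ᵥ F y v ::ᵥ v)
    have hS : Primrec₂ S := primrec_sum_range (hU.comp (Primrec.vector_cons.comp .snd
      (Primrec.vector_cons.comp (hF.comp .fst .snd) .fst)))
    refine ⟨.comp .snd (.comp (.iter (.pair (.comp .succ (.comp .fst (.get 1)))
        (.comp q (.pair (.comp .fst (.get 1)) (.pair (.comp .snd (.get 1)) (.comp .snd .snd))))))
        (.pair .fst (.pair (.pair (.const 0) (.comp p .snd)) .snd))),
      fun v => T v.tail + v.head * (S v.tail v.head + 100) + 100, ?_, fun ω Q v => ?_⟩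
    · exact Primrec.nat_add.comp (Primrec.nat_add.comp (hT.comp .vector_tail)
        (Primrec.nat_mul.comp .vector_head (Primrec.nat_add.comp
          (hS.comp .vector_tail .vector_head) (.const _)))) (.const _)
    · obtain ⟨m, v, rfl⟩ : ∃ m v', v = m ::ᵥ v' := ⟨v.head, v.tail, (v.cons_head_tail).symm⟩
      obtain ⟨w, ⟨-, rfl⟩, hr⟩ := Run.iter (ω := ω) (Q := Q) (ρ := numList v.toList)
        (T := S v m + 40) (m := 0)
        (body := .pair (.comp .succ (.comp .fst (.get 1)))
          (.comp q (.pair (.comp .fst (.get 1)) (.pair (.comp .snd (.get 1)) (.comp .snd .snd)))))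
        -- The loop counts down whereas the recursion counts up, so the state carries the upward
        -- counter `m - i` next to the value.
        (fun i w => i ≤ m ∧ w = .pair (.num (m - i)) (.num (F (m - i) v))) m
        (fun i hi w hw => by
          obtain ⟨hi', rfl⟩ := hw
          refine ⟨_, ⟨hi.le, rfl⟩, ?_⟩
          have hb := hq ω Q ((m - (i + 1)) ::ᵥ F (m - (i + 1)) v ::ᵥ v)
          refine (((((Run.get 1 _).comp (Run.fst _)).comp (Run.succ _)).pair
            ((((Run.get 1 _).comp (Run.fst _)).pair (((Run.get 1 _).comp (Run.snd _)).pair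
              ((Run.snd _).comp (Run.snd _)))).comp hb))).cast ?_ ?_ (by omega)
          · have : m - i = m - (i + 1) + 1 := by omega
            rw [this]
            rfl
          · have : U ((m - (i + 1)) ::ᵥ F (m - (i + 1)) v ::ᵥ v) ≤ S v m :=
              Finset.single_le_sum (f := fun y => U (y ::ᵥ F y v ::ᵥ v)) (fun _ _ => Nat.zero_le _)
                (Finset.mem_range.2 (by omega))
            omega)
        (.pair (.num 0) (.num (f v))) ⟨le_rfl, by simp [F]⟩
      have hin : Run ω Q (.pair .fst (.pair (.pair (.const 0) (.comp p .snd)) .snd))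
          (numList (m ::ᵥ v).toList) (.pair (.num m) (.pair (.pair (.num 0) (.num (f v)))
            (numList v.toList))) (T v + 10) 0 :=
        ((Run.fst _).pair (((Run.const 0 _).pair ((Run.snd _).comp (hp ω Q v))).pair
          (Run.snd _))).cast rfl (by omega) rfl
      refine ((hin.comp hr).comp (Run.snd _)).cast rfl ?_ (by omega)
      simp only [List.Vector.tail_cons, List.Vector.head_cons, Nat.mul_add]
      omega

/-- Every computable function is computed by some program in computable time. -/
theorem exists_prog_of_computable {f : ℕ → ℕ} (hf : Computable f) :
    ∃ (p : Prog) (T : ℕ → ℕ), Computable T ∧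
      ∀ ω Q n, Run ω Q p (.num n) (.num (f n)) (T n) 0 := by
  obtain ⟨c, hc⟩ := Nat.Partrec.Code.exists_code.1 (Partrec.nat_iff.1 hf)
  have hex : ∀ n, ∃ s, (Nat.Partrec.Code.evaln s c n).isSome = true := by
    intro n
    obtain ⟨s, hs⟩ := Nat.Partrec.Code.evaln_complete.1
      (show f n ∈ c.eval n by rw [hc]; exact Part.mem_some _)
    exact ⟨s, by rw [Option.mem_def.1 hs]; rfl⟩
  have hval : ∀ s n, (Nat.Partrec.Code.evaln s c n).isSome = true →
      Nat.Partrec.Code.evaln s c n = some (f n) := by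
    intro s n h
    obtain ⟨a, ha⟩ := Option.isSome_iff_exists.1 h
    have := Nat.Partrec.Code.evaln_sound (Option.mem_def.2 ha)
    rw [hc] at this
    rw [ha, Part.mem_some_iff.1 this]
  -- Normal form: `F s n` is `0` if the evaluation with bound `s` gives no value, and `f n + 1`
  -- otherwise. It is primitive recursive, so the program searches for the least `s` with `F s n ≠
  -- 0` and takes the predecessor.
  let F : ℕ → ℕ → ℕ := fun s n => ((Nat.Partrec.Code.evaln s c n).map Nat.succ).getD 0
  have hev : Primrec₂ fun s n => Nat.Partrec.Code.evaln s c n :=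
    Nat.Partrec.Code.primrec_evaln.comp ((Primrec.fst.pair (.const c)).pair .snd)
  have hF : Primrec₂ F := Primrec.option_getD.comp
    (Primrec.option_map hev (Primrec.succ.comp .snd)) (.const 0)
  obtain ⟨q, U, hU, hq⟩ := exists_prog_of_primrec' (Nat.Primrec'.prim_iff₂.2 hF)
  let N : ℕ → ℕ := fun n => Nat.find (hex n)
  -- The number of rounds of the search is itself computable; this makes the running time
  -- computable.
  have hN : Computable N := Computable.find (P := fun n s =>
    (Nat.Partrec.Code.evaln s c n).isSome = true) (ComputablePred.computable_iff.2
      ⟨fun p => (Nat.Partrec.Code.evaln p.2 c p.1).isSome, (Primrec.option_isSome.comp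
        (hev.comp .snd .fst)).to_comp, rfl⟩) hex
  let S : ℕ → ℕ → ℕ := fun n m => ∑ s ∈ Finset.range m, U (s ::ᵥ n ::ᵥ List.Vector.nil)
  have hS : Primrec₂ S := primrec_sum_range (hU.comp (Primrec.vector_cons.comp .snd
    (Primrec.vector_cons.comp .fst (.const List.Vector.nil))))
  let env : Prog := .pair .fst (.pair .snd (.const 0))
  have henv : ∀ ω Q s n, Run ω Q (.comp q env) (.pair (.num s) (.num n)) (.num (F s n))
      (U (s ::ᵥ n ::ᵥ List.Vector.nil) + 10) 0 := fun ω Q s n =>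
    (((Run.fst _).pair ((Run.snd _).pair (Run.const 0 _))).comp
      (hq ω Q (s ::ᵥ n ::ᵥ List.Vector.nil))).cast rfl (by omega) (by omega)
  have hU_le : ∀ n, ∀ s ≤ N n, U (s ::ᵥ n ::ᵥ List.Vector.nil) ≤ S n (N n + 1) := fun n s hs =>
    Finset.single_le_sum (f := fun s => U (s ::ᵥ n ::ᵥ List.Vector.nil)) (fun _ _ => Nat.zero_le _)
      (Finset.mem_range.2 (by omega))
  have hFN : ∀ n, F (N n) n = f n + 1 := by
    intro n
    simp only [F, N]
    rw [hval _ n (Nat.find_spec (hex n))]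
    rfl
  refine ⟨.comp (.comp .pred (.comp q env)) (.comp (.while (.ite (.comp q env) (.const 0) (.const 1))
    (.pair (.comp .succ .fst) .snd)) (.pair (.const 0) .id)),
    fun n => N n * (S n (N n + 1) + 30) + 2 * S n (N n + 1) + 60, ?_, fun ω Q n => ?_⟩
  · have hSN : Computable fun n => S n (N n + 1) :=
      hS.to_comp.comp .id (Computable.succ.comp hN)
    exact Primrec.nat_add.to_comp.comp (Primrec.nat_add.to_comp.comp
      (Primrec.nat_mul.to_comp.comp hN (Primrec.nat_add.to_comp.comp hSN (.const _)))
      (Primrec.nat_mul.to_comp.comp (.const 2) hSN)) (.const _)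
  · have hF0 : ∀ s < N n, F s n = 0 := by
      intro s hs
      simp only [F, Option.not_isSome_iff_eq_none.1 (Nat.find_min (hex n) hs)]
      rfl
    have hloop : ∀ j ≤ N n, Run ω Q (.while (.ite (.comp q env) (.const 0) (.const 1))
        (.pair (.comp .succ .fst) .snd)) (.pair (.num (N n - j)) (.num n))
        (.pair (.num (N n)) (.num n)) (j * (S n (N n + 1) + 30) + S n (N n + 1) + 20) 0 := by
      intro j hj
      have h0 := hU_le n (N n - j) (by omega)
      have he := henv ω Q (N n - j) n
      induction j with
      | zero =>
        have hne : Val.num (F (N n - 0) n) ≠ Val.num 0 := by simp [hFN n]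
        exact (Run.while_false (Run.ite_true he hne (Run.const 0 _))).cast rfl (by omega) (by omega)
      | succ j ih =>
        rw [hF0 _ (by omega)] at he
        have hs : Val.num (N n - j) = (Val.num (N n - (j + 1))).succ := by
          simp only [Val.succ, Val.num.injEq]
          omega
        have ih' := ih (by omega) (hU_le n _ (by omega)) (henv ω Q _ n)
        rw [hs] at ih'
        refine (Run.while_true (Run.ite_false he (Run.const 1 _)) (by simp)
          (((Run.fst _).comp (Run.succ _)).pair (Run.snd _)) ih').cast rfl ?_ (by omega)
        rw [Nat.add_mul]
        omega
    have hstart := hloop (N n) le_rfl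
    rw [Nat.sub_self] at hstart
    refine ((((Run.const 0 _).pair (Run.id _)).comp hstart).comp
      ((henv ω Q (N n) n).comp (Run.pred _))).cast ?_ ?_ (by omega)
    · rw [hFN n]
      rfl
    · have := hU_le n (N n) le_rfl
      change _ ≤ N n * (S n (N n + 1) + 30) + 2 * S n (N n + 1) + 60
      omega

/-! ### Independent sets and bicliques -/

/-- Colour each pair `(a, b)` by the positions, within `X a` and `Y b`, of two related elements.
There are `(i * j) ^ q` possible rows of colours, so some `d` of the `a` have the same row `φ`, and
`φ` takes one colour `c` on some `d` of the `b`. The elements in the positions given by `c` form the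
biclique; they are distinct because the sets are disjoint. -/
theorem exists_biclique {α β : Type*} (r : α → β → Prop) {p q i j d : ℕ} (X : Fin p → Finset α)
    (Y : Fin q → Finset β) (hX : ∀ a, (X a).card = i) (hY : ∀ b, (Y b).card = j)
    (hX' : Pairwise fun a b => Disjoint (X a) (X b))
    (hY' : Pairwise fun a b => Disjoint (Y a) (Y b))
    (hr : ∀ a b, ∃ x ∈ X a, ∃ y ∈ Y b, r x y) (hd : 0 < d)
    (hp : (d - 1) * (i * j) ^ q < p) (hq : (d - 1) * (i * j) < q) :
    ∃ (f : Fin d ↪ α) (g : Fin d ↪ β), (∀ a, ∃ c, f a ∈ X c) ∧ (∀ a, ∃ c, g a ∈ Y c) ∧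
      ∀ a b, r (f a) (g b) := by
  classical
  have hcol : ∀ a b, ∃ c : Fin i × Fin j, r ((X a).equivFinOfCardEq (hX a) |>.symm c.1)
      ((Y b).equivFinOfCardEq (hY b) |>.symm c.2) := by
    intro a b
    obtain ⟨x, hx, y, hy, h⟩ := hr a b
    exact ⟨((X a).equivFinOfCardEq (hX a) ⟨x, hx⟩, (Y b).equivFinOfCardEq (hY b) ⟨y, hy⟩),
      by simpa using h⟩
  choose col hcol using hcol
  obtain ⟨φ, -, hφ⟩ := Finset.exists_lt_card_fiber_of_mul_lt_card_of_maps_to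
    (s := Finset.univ) (t := Finset.univ) (f := col) (n := d - 1) (fun _ _ => Finset.mem_univ _)
    (by simpa [mul_comm] using hp)
  obtain ⟨c, -, hc⟩ := Finset.exists_lt_card_fiber_of_mul_lt_card_of_maps_to
    (s := Finset.univ) (t := Finset.univ) (f := φ) (n := d - 1) (fun _ _ => Finset.mem_univ _)
    (by simpa [mul_comm] using hq)
  let σ := Finset.orderEmbOfCardLe _ (show d ≤ _ by omega : d ≤ (Finset.univ.filter (col · = φ)).card)
  let τ := Finset.orderEmbOfCardLe _ (show d ≤ _ by omega : d ≤ (Finset.univ.filter (φ · = c)).card)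
  have hσ : ∀ a, col (σ a) = φ := fun a =>
    (Finset.mem_filter.1 (Finset.orderEmbOfCardLe_mem (Finset.univ.filter (col · = φ)) _ a)).2
  have hτ : ∀ a, φ (τ a) = c := fun a =>
    (Finset.mem_filter.1 (Finset.orderEmbOfCardLe_mem (Finset.univ.filter (φ · = c)) _ a)).2
  let f : Fin d → α := fun a => ((X (σ a)).equivFinOfCardEq (hX (σ a))).symm c.1
  let g : Fin d → β := fun a => ((Y (τ a)).equivFinOfCardEq (hY (τ a))).symm c.2
  have hf : ∀ a, f a ∈ X (σ a) := fun a => Subtype.property _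
  have hg : ∀ a, g a ∈ Y (τ a) := fun a => Subtype.property _
  refine ⟨⟨f, fun a b h => ?_⟩, ⟨g, fun a b h => ?_⟩, fun a => ⟨_, hf a⟩, fun a => ⟨_, hg a⟩,
    fun a b => ?_⟩
  · by_contra hab
    exact Finset.disjoint_left.1 (hX' fun h' => hab (σ.injective h')) (hf a) (h ▸ hf b)
  · by_contra hab
    exact Finset.disjoint_left.1 (hY' fun h' => hab (τ.injective h')) (hg a) (h ▸ hg b)
  · have := hcol (σ a) (τ b)
    rwa [hσ a, hτ b] at this

/-- There are `c` disjoint independent sets of size `s` in `U`. -/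
def HasFamily (G : FGraph) (U : Finset ℕ) (s c : ℕ) : Prop :=
  ∃ X : Fin c → Finset ℕ, (∀ a, X a ⊆ U ∧ G.graph.IsNIndepSet s (X a)) ∧
    Pairwise fun a b => Disjoint (X a) (X b)

theorem HasFamily.mono {G U s c c'} (h : HasFamily G U s c) (hc : c' ≤ c) :
    HasFamily G U s c' := by
  obtain ⟨X, hX, hX'⟩ := h
  exact ⟨fun a => X (a.castLE hc), fun a => hX _,
    fun a b hab => hX' fun h => hab (Fin.castLE_injective hc h)⟩

theorem HasFamily.zero (G U s) : HasFamily G U s 0 :=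
  ⟨Fin.elim0, fun a => a.elim0, fun a => a.elim0⟩

theorem HasFamily.insert {G U U' s c S} (h : HasFamily G U s c) (hUU' : U ⊆ U') (hS : S ⊆ U')
    (hdis : Disjoint S U) (hind : G.graph.IsNIndepSet s S) : HasFamily G U' s (c + 1) := by
  obtain ⟨X, hX, hX'⟩ := h
  refine ⟨Fin.cons S X, fun a => ?_, fun a b => ?_⟩
  · refine Fin.cases ⟨hS, hind⟩ (fun a => ⟨(hX a).1.trans hUU', (hX a).2⟩) a
  · refine Fin.cases ?_ (fun a => ?_) a <;> refine Fin.cases ?_ (fun b => ?_) b <;> intro hab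
    · exact absurd rfl hab
    · exact hdis.mono_right (hX b).1
    · exact (hdis.mono_right (hX a).1).symm
    · exact hX' fun h => hab (congrArg _ h)

theorem hasFamily_one (G : FGraph) {U : Finset ℕ} {c : ℕ} (hc : c ≤ U.card) :
    HasFamily G U 1 c := by
  refine ⟨fun a => {U.orderEmbOfCardLe hc a}, fun a => ⟨?_, ?_⟩, fun a b hab => ?_⟩
  · simpa using Finset.orderEmbOfCardLe_mem U hc a
  · simp [SimpleGraph.isNIndepSet_iff]
  · simpa using hab

/-- There is no biclique with `d` vertices in `A` and `d` vertices in `B`. -/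
def BicliqueFree (G : FGraph) (A B : Finset ℕ) (d : ℕ) : Prop :=
  ∀ f g : Fin d ↪ ℕ, (∀ a, f a ∈ A) → (∀ b, g b ∈ B) → ∃ a b, ¬G.graph.Adj (f a) (g b)

theorem BicliqueFree.symm {G A B d} (h : BicliqueFree G A B d) : BicliqueFree G B A d := by
  intro f g hf hg
  obtain ⟨a, b, hab⟩ := h g f hg hf
  exact ⟨b, a, fun h => hab h.symm⟩

theorem BicliqueFree.pos {G A B d} (h : BicliqueFree G A B d) : 0 < d := by
  rcases Nat.eq_zero_or_pos d with rfl | h'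
  · obtain ⟨a, -⟩ := h ⟨Fin.elim0, fun a => a.elim0⟩ ⟨Fin.elim0, fun a => a.elim0⟩
      (fun a => a.elim0) (fun a => a.elim0)
    exact a.elim0
  · exact h'

theorem bicliqueFree_of_free {G : FGraph} {A B : Finset ℕ} {d : ℕ} (hAB : Disjoint A B)
    (h : (completeBipartiteGraph (Fin d) (Fin d)).Free
      (G.graph.between (A : Set ℕ) (B : Set ℕ))) : BicliqueFree G A B d := by
  intro f g hf hg
  by_contra! hcon
  refine h ⟨⟨⟨Sum.elim f g, ?_⟩, ?_⟩⟩
  · rintro (a | a) (b | b) hab <;> simp at hab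
    · simp [SimpleGraph.between_adj, hcon a b, hf a, hg b]
    · simp [SimpleGraph.between_adj, (hcon b a).symm, hf b, hg a]
  · rintro (a | a) (b | b) hab
    · exact congrArg _ (f.injective hab)
    · exact absurd (show f a = g b from hab) fun h =>
        Finset.disjoint_left.1 hAB (hf a) (h ▸ hg b)
    · exact absurd (show g a = f b from hab) fun h =>
        Finset.disjoint_left.1 hAB (hf b) (h ▸ hg a)
    · exact congrArg _ (g.injective hab)

/-- If no `X a ∪ Y b` is a solution, an edge joins each `X a` to each `Y b`, and `exists_biclique`
applies. Only `(d - 1) * (i * j) + 1` sets are used in `B`, as their number is the exponent in the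
bound on `p`. -/
theorem yes_of_hasFamily {G : FGraph} {A B : Finset ℕ} {d i j p : ℕ} (hAB : Disjoint A B)
    (hA : A ⊆ G.verts) (hB : B ⊆ G.verts) (hfree : BicliqueFree G A B d)
    (hX : HasFamily G A i p) (hY : HasFamily G B j ((d - 1) * (i * j) + 1))
    (hp : (d - 1) * (i * j) ^ ((d - 1) * (i * j) + 1) < p) : Yes (G, i + j) := by
  classical
  obtain ⟨X, hX, hX'⟩ := hX
  obtain ⟨Y, hY, hY'⟩ := hY
  by_contra hno
  have hr : ∀ a b, ∃ x ∈ X a, ∃ y ∈ Y b, G.graph.Adj x y := by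
    intro a b
    by_contra! hcon
    refine hno ⟨X a ∪ Y b, Finset.union_subset ((hX a).1.trans hA) ((hY b).1.trans hB), ?_, ?_⟩
    · intro x hx y hy hxy hadj
      simp only [Finset.coe_union, Set.mem_union, Finset.mem_coe] at hx hy
      rcases hx with hx | hx <;> rcases hy with hy | hy
      · exact (hX a).2.1 hx hy hxy hadj
      · exact hcon x hx y hy hadj
      · exact hcon y hy x hx hadj.symm
      · exact (hY b).2.1 hx hy hxy hadj
    · rw [Finset.card_union_of_disjoint (hAB.mono (hX a).1 (hY b).1), (hX a).2.2, (hY b).2.2]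
  obtain ⟨f, g, hf, hg, hfg⟩ := exists_biclique G.graph.Adj X Y (fun a => (hX a).2.2)
    (fun b => (hY b).2.2) hX' hY' hr hfree.pos hp (by omega)
  obtain ⟨a, b, hab⟩ := hfree f g (fun a => (hf a).elim fun c hc => (hX c).1 hc)
    (fun a => (hg a).elim fun c hc => (hY c).1 hc)
  exact hab (hfg a b)

theorem yes_of_le_alpha {G : FGraph} {k : ℕ} (hk : k ≤ G.alpha) : Yes (G, k) := by
  obtain ⟨S, hS⟩ := SimpleGraph.exists_isNIndepSet_indepNum
    (G := G.graph.induce (G.verts : Set ℕ))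
  obtain ⟨T, hTS, hT⟩ := Finset.exists_subset_card_eq (hk.trans_eq hS.2.symm)
  refine ⟨T.map (Function.Embedding.subtype _), ?_, ?_, ?_⟩
  · intro x hx
    obtain ⟨y, -, rfl⟩ := Finset.mem_map.1 hx
    exact y.2
  · intro x hx y hy hxy
    obtain ⟨x, hxT, rfl⟩ := Finset.mem_map.1 hx
    obtain ⟨y, hyT, rfl⟩ := Finset.mem_map.1 hy
    exact hS.1 (hTS hxT) (hTS hyT) fun h => hxy (congrArg _ h)
  · simpa using hT

theorem isSolution_restrict {G : FGraph} {U S : Finset ℕ} {s : ℕ} :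
    IsSolution (G.restrict U, s) S ↔ S ⊆ G.verts ∩ U ∧ G.graph.IsNIndepSet s S := by
  refine and_congr_right fun hS => ?_
  simp only [SimpleGraph.isNIndepSet_iff]
  refine and_congr_left fun _ => ?_
  refine ⟨fun h x hx y hy hxy hadj => h hx hy hxy ⟨hadj, ?_, ?_⟩,
    fun h x hx y hy hxy hadj => h hx hy hxy hadj.1⟩
  · exact (Finset.mem_inter.1 (hS hx)).2
  · exact (Finset.mem_inter.1 (hS hy)).2

theorem yes_of_yes_nonNbrs {G : FGraph} {v k : ℕ} (hv : v ∈ G.verts)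
    (h : Yes (G.restrict (G.nonNbrs v), k)) : Yes (G, k + 1) := by
  classical
  obtain ⟨S, hS⟩ := h
  obtain ⟨hSV, hS, hcard⟩ := isSolution_restrict.1 hS
  have hN : ∀ x ∈ S, x ≠ v ∧ ¬G.graph.Adj v x := fun x hx =>
    (Finset.mem_filter.1 (Finset.mem_inter.1 (hSV hx)).2).2
  refine ⟨insert v S, Finset.insert_subset hv (hSV.trans Finset.inter_subset_left), ?_, ?_⟩
  · rw [Finset.coe_insert, SimpleGraph.isIndepSet_iff, Set.pairwise_insert]
    exact ⟨hS, fun x hx _ => ⟨(hN x hx).2, fun h => (hN x hx).2 h.symm⟩⟩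
  · rw [Finset.card_insert_of_notMem fun h => (hN v h).1 rfl, hcard]

theorem yes_nonNbrs_of_isSolution {G : FGraph} {v k : ℕ} {S : Finset ℕ}
    (hS : IsSolution (G, k + 1) S) (hv : v ∈ S) : Yes (G.restrict (G.nonNbrs v), k) := by
  classical
  obtain ⟨hSV, hS, hcard⟩ := hS
  refine ⟨S.erase v, isSolution_restrict.2 ⟨fun x hx => ?_, ?_, ?_⟩⟩
  · obtain ⟨hxv, hx⟩ := Finset.mem_erase.1 hx
    exact Finset.mem_inter.2 ⟨hSV hx, Finset.mem_filter.2 ⟨hSV hx, hxv, hS hv hx hxv.symm⟩⟩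
  · exact hS.mono (by simp)
  · rw [Finset.card_erase_of_mem hv]
    change S.card = k + 1 at hcard
    omega

theorem exists_subset_isNIndepSet {G : SimpleGraph ℕ} {S : Finset ℕ} (hS : G.IsIndepSet S) {s : ℕ}
    (hs : s ≤ S.card) : ∃ T ⊆ S, G.IsNIndepSet s T := by
  obtain ⟨T, hTS, hT⟩ := Finset.exists_subset_card_eq hs
  exact ⟨T, hTS, hS.mono hTS, hT⟩

/-! ### The reduction -/

theorem Run.inter_encFinset (S : Finset ℕ) (M : Val) {n N : ℕ} (hn : S.card ≤ n)
    (hN : M.toList.length ≤ N) :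
    Run ω Q .inter (.pair (encFinset S) M) (encFinset (S.filter fun a => memVal a M = true))
      (filterTime n N) 0 :=
  (Run.inter (S.sort (· ≤ ·)) M (by simpa using hn) hN).cast
    (by rw [encFinset_eq, sort_filter]) le_rfl rfl

theorem Run.diff_encFinset (S T : Finset ℕ) {n N : ℕ} (hn : S.card ≤ n) (hN : T.card ≤ N) :
    Run ω Q .diff (.pair (encFinset S) (encFinset T)) (encFinset (S \ T)) (filterTime n N) 0 := by
  refine (Run.diff (S.sort (· ≤ ·)) (encFinset T) (by simpa using hn)
    ((length_toList_encFinset T).trans_le hN)).cast ?_ le_rfl rfl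
  rw [encFinset_eq (S \ T), ← sort_filter]
  congr 2
  ext a
  simp [Finset.mem_sdiff, memVal_encFinset, ← Bool.not_eq_true]

/-- One step of the search for disjoint independent sets, on input `(i, ((U, (L, b)), (G, s)))`:
asks for an independent set of size `s` in `U`, and moves its vertices from `U` to `L`. -/
def Prog.famStep : Prog :=
  .letp (.comp .call (.pair (.comp .induce (.pair (.get 2) (.comp .fst (.get 1)))) (.get 3)))
    (.ite (.comp .isPair (.get 0))
      (.pair (.comp .diff (.pair (.comp .fst (.get 2)) (.comp .snd (.get 0))))
        (.pair (.comp .revOnto (.pair (.comp .snd (.get 0)) (.comp .fst (.comp .snd (.get 2)))))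
          (.const 1)))
      (.pair (.comp .fst (.get 2)) (.pair (.comp .fst (.comp .snd (.get 2))) (.const 0))))

def famStepTime (n : ℕ) : ℕ := induceTime n n + filterTime n n + n * 23 + 150

def famEnv (G : FGraph) (s : ℕ) : Val :=
  .pair (encGraph G) (.pair (.num s) (.num 0))

def famAcc (U : Finset ℕ) (L : List ℕ) (b : Bool) : Val :=
  .pair (encFinset U) (.pair (numList L) (encBool b))

theorem Run.famStep_of_isSolution {G : FGraph} {s i n : ℕ} {U S : Finset ℕ} {L : List ℕ} {b : Bool}
    (hn : G.verts.card ≤ n) (hU : U ⊆ G.verts) (hQ : Q (G.restrict U, s))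
    (hS : S ⊆ G.verts) (hω : ω (encInst (G.restrict U, s)) = .pair (.num 1) (encFinset S)) :
    Run ω Q .famStep (.pair (.num i) (.pair (famAcc U L b) (famEnv G s)))
      (famAcc (U \ S) ((S.sort (· ≤ ·)).reverse ++ L) true) (famStepTime n) 1 := by
  have hUn : (encFinset U).toList.length ≤ n :=
    (length_toList_encFinset U).trans_le ((Finset.card_le_card hU).trans hn)
  have hSn : (encFinset S).toList.length ≤ n :=
    (length_toList_encFinset S).trans_le ((Finset.card_le_card hS).trans hn)
  have hq : Run ω Q (.comp .call (.pair (.comp .induce (.pair (.get 2) (.comp .fst (.get 1))))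
      (.get 3))) (.pair (.num i) (.pair (famAcc U L b) (famEnv G s)))
      (.pair (.num 1) (encFinset S)) _ _ :=
    (((((Run.get 2 _).pair ((Run.get 1 _).comp (Run.fst _))).comp
      (Run.induce G (encFinset U) U (fun a => memVal_encFinset) hn hUn)).pair (Run.get 3 _)).comp
      (Run.call hQ)).cast hω le_rfl rfl
  have hd := Run.diff_encFinset (ω := ω) (Q := Q) U S
    ((Finset.card_le_card hU).trans hn) ((Finset.card_le_card hS).trans hn)
  refine (hq.letp (Run.ite_true ((Run.get 0 _).comp (Run.isPair _)) (by simp [nth, Val.fst, Val.isPair])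
    (((((Run.get 2 _).comp (Run.fst _)).pair ((Run.get 0 _).comp (Run.snd _))).comp hd).pair
      (((((Run.get 0 _).comp (Run.snd _)).pair
        (((Run.get 2 _).comp (Run.snd _)).comp (Run.fst _))).comp
          (Run.revOnto (encFinset S) (L.map Val.num))).pair (Run.const 1 _))))).cast ?_ ?_ ?_
  · simp [famAcc, numList, encFinset_eq, encBool]
  · unfold famStepTime
    have := Nat.mul_le_mul_right 23 hSn
    omega
  · omega

theorem Run.famStep_of_not_yes {G : FGraph} {s i n : ℕ} {U : Finset ℕ} {L : List ℕ} {b : Bool}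
    (hn : G.verts.card ≤ n) (hU : U ⊆ G.verts) (hQ : Q (G.restrict U, s))
    (hω : ω (encInst (G.restrict U, s)) = .num 0) :
    Run ω Q .famStep (.pair (.num i) (.pair (famAcc U L b) (famEnv G s)))
      (famAcc U L false) (famStepTime n) 1 := by
  have hUn : (encFinset U).toList.length ≤ n :=
    (length_toList_encFinset U).trans_le ((Finset.card_le_card hU).trans hn)
  have hq : Run ω Q (.comp .call (.pair (.comp .induce (.pair (.get 2) (.comp .fst (.get 1))))
      (.get 3))) (.pair (.num i) (.pair (famAcc U L b) (famEnv G s))) (.num 0) _ _ :=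
    (((((Run.get 2 _).pair ((Run.get 1 _).comp (Run.fst _))).comp
      (Run.induce G (encFinset U) U (fun a => memVal_encFinset) hn hUn)).pair (Run.get 3 _)).comp
      (Run.call hQ)).cast hω le_rfl rfl
  refine (hq.letp (Run.ite_false ((Run.get 0 _).comp (Run.isPair _))
    ((((Run.get 2 _).comp (Run.fst _)).pair
      ((((Run.get 2 _).comp (Run.snd _)).comp (Run.fst _)).pair (Run.const 0 _)))))).cast ?_ ?_ ?_
  · rfl
  · unfold famStepTime
    omega
  · omega

/-- After a failure `U` no longer changes, so all later rounds ask the same question and fail too;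
hence the final `b` tells whether every round succeeded. If not, no independent set of size `s` is
left in `U`, and all that was removed from `U` lies in `L`. -/
theorem Run.fam {G : FGraph} {s n P : ℕ} {U₀ : Finset ℕ} {L₀ : List ℕ}
    (hω : SolvesMIS ω) (hn : G.verts.card ≤ n) (hU₀ : U₀ ⊆ G.verts) (hL₀ : ∀ x ∈ L₀, x ∈ G.verts)
    (hP : 0 < P) (hQ : ∀ U, Q (G.restrict U, s)) :
    ∃ U L b, Run ω Q (.iter .famStep)
        (.pair (.num P) (.pair (famAcc U₀ L₀ false) (famEnv G s))) (famAcc U L b)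
        (P * (famStepTime n + 12) + 8) P ∧
      (∀ x ∈ L₀, x ∈ L) ∧ (∀ x ∈ L, x ∈ G.verts) ∧ L.length ≤ L₀.length + P * s ∧
      (b = true → HasFamily G U₀ s P) ∧
      (b = false → ∀ T ⊆ U₀, G.graph.IsNIndepSet s T → ∃ x ∈ T, x ∈ L) := by
  let Inv : ℕ → Val → Prop := fun i v => ∃ U L b, v = famAcc U L b ∧ U ⊆ U₀ ∧
    (∀ x ∈ U₀, x ∉ U → x ∈ L) ∧ (∀ x ∈ L₀, x ∈ L) ∧ (∀ x ∈ L, x ∈ G.verts) ∧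
    L.length + i * s ≤ L₀.length + P * s ∧
    -- At the start `b` is `false` although nothing has failed; the case `i = P` is therefore exempt
    -- here and in the next clause.
    ((b = true ∨ i = P) → HasFamily G (U₀ \ U) s (P - i)) ∧
    (b = false → i < P → ¬Yes (G.restrict U, s))
  have hstep : ∀ i < P, ∀ v, Inv (i + 1) v → ∃ w, Inv i w ∧
      Run ω Q .famStep (.pair (.num (i + 1)) (.pair v (famEnv G s))) w (famStepTime n) 1 := by
    rintro i hi v ⟨U, L, b, rfl, hU, hUL, hL₀L, hL, hlen, hb, hb'⟩
    rcases hω (G.restrict U, s) with ⟨S, hS, hans⟩ | ⟨hno, hans⟩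
    · have hS' := isSolution_restrict.1 hS
      have hSV : S ⊆ G.verts := hS'.1.trans Finset.inter_subset_left
      have hSU : S ⊆ U := hS'.1.trans Finset.inter_subset_right
      refine ⟨_, ⟨U \ S, _, true, rfl, Finset.sdiff_subset.trans hU, fun x hx hxU => ?_,
        fun x hx => ?_, fun x hx => ?_, ?_, fun _ => ?_, fun h => by simp at h⟩,
        Run.famStep_of_isSolution hn (hU.trans hU₀) (hQ U) hSV hans⟩
      · by_cases hxS : x ∈ S
        · simp [hxS]
        · exact List.mem_append_right _ (hUL x hx fun h => hxU (Finset.mem_sdiff.2 ⟨h, hxS⟩))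
      · exact List.mem_append_right _ (hL₀L x hx)
      · rcases List.mem_append.1 hx with hx | hx
        · exact hSV (by simpa using hx)
        · exact hL x hx
      · have : S.card = s := hS'.2.2
        simp only [List.length_append, List.length_reverse, Finset.length_sort, this]
        rw [Nat.add_mul] at hlen
        omega
      · have hfam : HasFamily G (U₀ \ U) s (P - (i + 1)) := by
          refine hb ?_
          by_contra! hcon
          exact hb' (by simpa using hcon.1) (by omega) ⟨S, hS⟩
        have : P - i = P - (i + 1) + 1 := by omega
        rw [this]
        exact hfam.insert (Finset.sdiff_subset_sdiff subset_rfl Finset.sdiff_subset)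
          (fun x hx => Finset.mem_sdiff.2 ⟨hU (hSU hx), fun h => (Finset.mem_sdiff.1 h).2 hx⟩)
          (Finset.disjoint_left.2 fun x hx h => (Finset.mem_sdiff.1 h).2 (hSU hx)) hS'.2
    · refine ⟨_, ⟨U, L, false, rfl, hU, hUL, hL₀L, hL, ?_, fun h => ?_, fun _ _ => hno⟩,
        Run.famStep_of_not_yes hn (hU.trans hU₀) (hQ U) hans⟩
      · rw [Nat.add_mul] at hlen
        omega
      · rcases h with h | h
        · simp at h
        · omega
  obtain ⟨w, ⟨U, L, b, rfl, hU, hUL, hL₀L, hL, hlen, hb, hb'⟩, hr⟩ :=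
    Run.iter Inv P hstep (famAcc U₀ L₀ false)
      ⟨U₀, L₀, false, rfl, subset_rfl, fun x hx hx' => absurd hx hx', fun x hx => hx, hL₀, le_rfl,
        fun _ => by rw [Nat.sub_self]; exact HasFamily.zero _ _ _, fun _ h => absurd h (lt_irrefl _)⟩
  refine ⟨U, L, b, hr.cast rfl le_rfl (by omega), hL₀L, hL, by omega, fun h => ?_,
    fun h T hT hTi => ?_⟩
  · obtain ⟨X, hX, hX'⟩ := hb (Or.inl h)
    exact ⟨X, fun a => ⟨(hX a).1.trans Finset.sdiff_subset, (hX a).2⟩, hX'⟩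
  · by_contra! hcon
    refine hb' h hP ⟨T, isSolution_restrict.2 ⟨fun x hx => Finset.mem_inter.2 ⟨hU₀ (hT hx), ?_⟩,
      hTi⟩⟩
    by_contra hxU
    exact hcon x hx (hUL x (hT hx) hxU)

/-- On input `(i, ((j, (L, b)), (G, (A, (B, P)))))`: looks for `P` disjoint independent sets of
size `i` in `A` and of size `j` in `B`, adds the vertices of those which are found to `L`, and
sets `b` if the search succeeds in `A` or `i = 1`, and it succeeds in `B` or `j = 1`. -/
def Prog.searchStep : Prog :=
  .letp (.comp (.iter .famStep) (.pair (.get 5) (.pair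
      (.pair (.get 3) (.pair (.comp .fst (.comp .snd (.get 1))) (.const 0)))
      (.pair (.get 2) (.pair (.get 0) (.const 0))))))
    (.letp (.comp (.iter .famStep) (.pair (.get 6) (.pair
        (.pair (.get 5) (.pair (.comp .fst (.comp .snd (.get 0))) (.const 0)))
        (.pair (.get 3) (.pair (.comp .fst (.get 2)) (.const 0))))))
      (.pair (.comp .succ (.comp .fst (.get 3))) (.pair (.comp .fst (.comp .snd (.get 0)))
        (.ite (.ite (.comp .snd (.comp .snd (.get 1))) (.const 1)
            (.comp .eqNum (.pair (.const 1) (.get 2))))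
          (.ite (.ite (.comp .snd (.comp .snd (.get 0))) (.const 1)
              (.comp .eqNum (.pair (.const 1) (.comp .fst (.get 3)))))
            (.const 1) (.comp .snd (.comp .snd (.get 3))))
          (.comp .snd (.comp .snd (.get 3)))))))

def searchEnv (G : FGraph) (A B : Finset ℕ) (P : ℕ) : Val :=
  .pair (encGraph G) (.pair (encFinset A) (.pair (encFinset B) (.pair (.num P) (.num 0))))

def searchAcc (j : ℕ) (L : List ℕ) (b : Bool) : Val :=
  .pair (.num j) (.pair (numList L) (encBool b))

def searchStepTime (n P : ℕ) : ℕ := 2 * (P * (famStepTime n + 12)) + 300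

theorem Run.or_eqNum_one {e f : Prog} {v : Val} {b : Bool} {i T T' : ℕ}
    (he : Run ω Q e v (encBool b) T 0) (hf : Run ω Q f v (.num i) T' 0) :
    Run ω Q (.ite e (.const 1) (.comp .eqNum (.pair (.const 1) f))) v
      (encBool (b || decide (i = 1))) (T + T' + 7) 0 := by
  refine (he.ite (fun _ => Run.const 1 _) (fun _ => ((Run.const 1 _).pair hf).comp
    (Run.eqNum_pair_num (.num i) 1))).cast ?_ (by omega) (by omega)
  cases b
  · simp
  · rfl

/-- A side of size 1 passes whatever its search yields, but its questions are asked all the same to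
keep the count uniform. In return, the failing side is known to have size other than 1, which
matters for solutions contained in `A` or in `B`. -/
theorem Run.searchStep {G : FGraph} {A B : Finset ℕ} {L : List ℕ} {b : Bool} {i j n P : ℕ}
    (hω : SolvesMIS ω) (hn : G.verts.card ≤ n) (hA : A ⊆ G.verts) (hB : B ⊆ G.verts)
    (hL : ∀ x ∈ L, x ∈ G.verts) (hP : 0 < P) (hQi : ∀ U, Q (G.restrict U, i))
    (hQj : ∀ U, Q (G.restrict U, j)) :
    ∃ L' b', Run ω Q .searchStep
        (.pair (.num i) (.pair (searchAcc j L b) (searchEnv G A B P)))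
        (searchAcc (j + 1) L' b') (searchStepTime n P) (P + P) ∧
      (∀ x ∈ L, x ∈ L') ∧ (∀ x ∈ L', x ∈ G.verts) ∧ L'.length ≤ L.length + P * (i + j) ∧
      (b' = true → b = true ∨
        ((HasFamily G A i P ∨ i = 1) ∧ (HasFamily G B j P ∨ j = 1))) ∧
      (b = true → b' = true) ∧
      (b' = true ∨ (i ≠ 1 ∧ ∀ T ⊆ A, G.graph.IsNIndepSet i T → ∃ x ∈ T, x ∈ L') ∨
        (j ≠ 1 ∧ ∀ T ⊆ B, G.graph.IsNIndepSet j T → ∃ x ∈ T, x ∈ L')) := by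
  obtain ⟨U₁, L₁, b₁, hr₁, hLL₁, hL₁, hlen₁, hb₁, hb₁'⟩ :=
    Run.fam (Q := Q) (U₀ := A) (L₀ := L) (s := i) hω hn hA hL hP hQi
  obtain ⟨U₂, L₂, b₂, hr₂, hLL₂, hL₂, hlen₂, hb₂, hb₂'⟩ :=
    Run.fam (Q := Q) (U₀ := B) (L₀ := L₁) (s := j) hω hn hB hL₁ hP hQj
  set e := Val.pair (.num i) (.pair (searchAcc j L b) (searchEnv G A B P)) with he
  have h₁ : Run ω Q (.comp (.iter .famStep) (.pair (.get 5) (.pair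
      (.pair (.get 3) (.pair (.comp .fst (.comp .snd (.get 1))) (.const 0)))
      (.pair (.get 2) (.pair (.get 0) (.const 0)))))) e _ _ _ :=
    ((Run.get 5 e).pair (((Run.get 3 e).pair ((((Run.get 1 e).comp (Run.snd _)).comp
      (Run.fst _)).pair (Run.const 0 e))).pair ((Run.get 2 e).pair ((Run.get 0 e).pair
        (Run.const 0 e))))).comp hr₁
  set e₁ := Val.pair (famAcc U₁ L₁ b₁) e with he₁
  have h₂ : Run ω Q (.comp (.iter .famStep) (.pair (.get 6) (.pair
        (.pair (.get 5) (.pair (.comp .fst (.comp .snd (.get 0))) (.const 0)))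
        (.pair (.get 3) (.pair (.comp .fst (.get 2)) (.const 0)))))) e₁ _ _ _ :=
    ((Run.get 6 e₁).pair (((Run.get 5 e₁).pair ((((Run.get 0 e₁).comp (Run.snd _)).comp
      (Run.fst _)).pair (Run.const 0 e₁))).pair ((Run.get 3 e₁).pair
        (((Run.get 2 e₁).comp (Run.fst _)).pair (Run.const 0 e₁))))).comp hr₂
  set e₂ := Val.pair (famAcc U₂ L₂ b₂) e₁ with he₂
  have hc₁ := Run.or_eqNum_one (ω := ω) (Q := Q) (v := e₂) (b := b₁) (i := i)
    (((Run.get 1 e₂).comp (Run.snd _)).comp (Run.snd _)) (Run.get 2 e₂)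
  have hc₂ := Run.or_eqNum_one (ω := ω) (Q := Q) (v := e₂) (b := b₂) (i := j)
    (((Run.get 0 e₂).comp (Run.snd _)).comp (Run.snd _)) ((Run.get 3 e₂).comp (Run.fst _))
  have hans : Run ω Q (.comp .snd (.comp .snd (.get 3))) e₂ (encBool b) _ _ :=
    ((Run.get 3 e₂).comp (Run.snd _)).comp (Run.snd _)
  have h₃ := ((((Run.get (ω := ω) (Q := Q) 3 e₂).comp (Run.fst _)).comp (Run.succ _)).pair
    (((((Run.get 0 e₂).comp (Run.snd _)).comp (Run.fst _))).pair
      (hc₁.ite (fun _ => hc₂.ite (fun _ => Run.const 1 _) (fun _ => hans))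
        (fun _ => hans))))
  refine ⟨L₂, ((b₁ || decide (i = 1)) && (b₂ || decide (j = 1))) || b,
    (h₁.letp (h₂.letp h₃)).cast ?_ ?_ (by omega), fun x hx => hLL₂ x (hLL₁ x hx), hL₂, ?_, ?_, ?_,
    ?_⟩
  · clear hb₁ hb₂ hb₁' hb₂' h₁ h₂ h₃ hc₁ hc₂ hr₁ hr₂
    generalize decide (i = 1) = x, decide (j = 1) = y
    cases b₁ <;> cases b₂ <;> cases x <;> cases y <;> cases b <;> rfl
  · unfold searchStepTime
    omega
  · rw [Nat.mul_add]
    omega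
  · simp only [Bool.or_eq_true, Bool.and_eq_true, decide_eq_true_eq]
    rintro (⟨h, h'⟩ | h)
    · exact Or.inr ⟨h.imp_left hb₁, h'.imp_left hb₂⟩
    · exact Or.inl h
  · intro h
    simp [h]
  · by_cases hA' : b₁ = true ∨ i = 1
    · by_cases hB' : b₂ = true ∨ j = 1
      · left
        simp only [Bool.or_eq_true, Bool.and_eq_true, decide_eq_true_eq]
        exact Or.inl ⟨hA', hB'⟩
      · rw [not_or, Bool.not_eq_true] at hB'
        exact Or.inr (Or.inr ⟨hB'.2, hb₂' hB'.1⟩)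
    · rw [not_or, Bool.not_eq_true] at hA'
      exact Or.inr (Or.inl ⟨hA'.2, fun T hT hTi =>
        (hb₁' hA'.1 T hT hTi).imp fun x hx => ⟨hx.1, hLL₂ x hx.2⟩⟩)

/-- The result of the search is positive. -/
def SearchSucceeds (G : FGraph) (A B : Finset ℕ) (P k : ℕ) : Prop :=
  ∃ i j, 0 < i ∧ 0 < j ∧ i + j = k ∧ (HasFamily G A i P ∨ i = 1) ∧ (HasFamily G B j P ∨ j = 1)

/-- While `i` counts down from `k - 1` to `1`, the stored `j` counts up from `1`, so all splits of
`k` into positive parts occur. Each round adds at most `P * k` vertices to `L`. -/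
theorem Run.search {G : FGraph} {A B : Finset ℕ} {L₀ : List ℕ} {b₀ : Bool} {k n P : ℕ}
    (hω : SolvesMIS ω) (hn : G.verts.card ≤ n) (hA : A ⊆ G.verts) (hB : B ⊆ G.verts)
    (hL₀ : ∀ x ∈ L₀, x ∈ G.verts) (hP : 0 < P) (hQ : ∀ U, ∀ s < k, Q (G.restrict U, s)) :
    ∃ L b, Run ω Q (.iter .searchStep)
        (.pair (.num (k - 1)) (.pair (searchAcc 1 L₀ b₀) (searchEnv G A B P)))
        (searchAcc (k - 1 + 1) L b) ((k - 1) * (searchStepTime n P + 12) + 8)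
        ((k - 1) * (P + P)) ∧
      (∀ x ∈ L₀, x ∈ L) ∧ (∀ x ∈ L, x ∈ G.verts) ∧ L.length ≤ L₀.length + (k - 1) * (P * k) ∧
      (b = true → b₀ = true ∨ SearchSucceeds G A B P k) ∧
      (b₀ = true → b = true) ∧
      ∀ i j, 0 < i → 0 < j → i + j = k → b = true ∨
        (i ≠ 1 ∧ ∀ T ⊆ A, G.graph.IsNIndepSet i T → ∃ x ∈ T, x ∈ L) ∨
        (j ≠ 1 ∧ ∀ T ⊆ B, G.graph.IsNIndepSet j T → ∃ x ∈ T, x ∈ L) := by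
  let Inv : ℕ → Val → Prop := fun m v => m ≤ k - 1 ∧ ∃ L b,
    v = searchAcc (k - 1 - m + 1) L b ∧ (∀ x ∈ L₀, x ∈ L) ∧ (∀ x ∈ L, x ∈ G.verts) ∧
    L.length + m * (P * k) ≤ L₀.length + (k - 1) * (P * k) ∧
    (b = true → b₀ = true ∨ SearchSucceeds G A B P k) ∧
    (b₀ = true → b = true) ∧
    ∀ i j, m < i → 0 < j → i + j = k → b = true ∨
      (i ≠ 1 ∧ ∀ T ⊆ A, G.graph.IsNIndepSet i T → ∃ x ∈ T, x ∈ L) ∨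
      (j ≠ 1 ∧ ∀ T ⊆ B, G.graph.IsNIndepSet j T → ∃ x ∈ T, x ∈ L)
  have hstep : ∀ m < k - 1, ∀ v, Inv (m + 1) v → ∃ w, Inv m w ∧
      Run ω Q .searchStep (.pair (.num (m + 1)) (.pair v (searchEnv G A B P))) w
        (searchStepTime n P) (P + P) := by
    rintro m hm v ⟨-, L, b, rfl, hL₀L, hL, hlen, hsound, hb, hcomp⟩
    have hj : k - 1 - m + 1 = k - 1 - (m + 1) + 1 + 1 := by omega
    obtain ⟨L', b', hr, hLL', hL', hlen', hs, hbb', hc⟩ :=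
      Run.searchStep (Q := Q) (b := b) (i := m + 1) (j := k - 1 - (m + 1) + 1) hω hn hA hB hL hP
        (fun U => hQ U _ (by omega)) (fun U => hQ U _ (by omega))
    have hij : m + 1 + (k - 1 - (m + 1) + 1) = k := by omega
    rw [hij] at hlen'
    refine ⟨_, ⟨hm.le, L', b', by rw [hj], fun x hx => hLL' x (hL₀L x hx), hL', ?_, fun h => ?_,
      fun h => hbb' (hb h), fun i j hi hj hijk => ?_⟩, hr⟩
    · rw [Nat.add_mul] at hlen
      omega
    · rcases hs h with h | h
      · exact hsound h
      · exact Or.inr ⟨m + 1, k - 1 - (m + 1) + 1, by omega, by omega, hij, h⟩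
    · rcases Nat.lt_or_ge (m + 1) i with hi' | hi'
      · rcases hcomp i j hi' hj hijk with h | h | h
        · exact Or.inl (hbb' h)
        · exact Or.inr (Or.inl ⟨h.1, fun T hT hTi =>
            (h.2 T hT hTi).imp fun x hx => ⟨hx.1, hLL' x hx.2⟩⟩)
        · exact Or.inr (Or.inr ⟨h.1, fun T hT hTi =>
            (h.2 T hT hTi).imp fun x hx => ⟨hx.1, hLL' x hx.2⟩⟩)
      · obtain rfl : i = m + 1 := by omega
        obtain rfl : j = k - 1 - (m + 1) + 1 := by omega
        exact hc
  obtain ⟨w, ⟨-, L, b, rfl, hL₀L, hL, hlen, hsound, hb, hcomp⟩, hr⟩ :=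
    Run.iter Inv (k - 1) hstep (searchAcc 1 L₀ b₀) ⟨le_rfl, L₀, b₀, by simp, fun x hx => hx, hL₀,
      le_rfl, Or.inl, fun h => h, fun i j hi hj hijk => by omega⟩
  exact ⟨L, b, hr, hL₀L, hL, by omega, hsound, hb, hcomp⟩

/-- On input `(G, (v, k))`: the instance `(G - N[v], k - 1)`. -/
def Prog.branchInst : Prog :=
  .pair (.comp .induce (.pair .fst (.comp .nonNbrs (.pair .fst (.get 1)))))
    (.comp .pred (.comp .snd .snd))

def branchTime (n : ℕ) : ℕ := nonNbrsTime n + induceTime n n + 50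

open Classical in
theorem Run.branchInst (G : FGraph) (v k : ℕ) (hv : v ∈ G.verts) {n : ℕ}
    (hn : G.verts.card ≤ n) :
    Run ω Q .branchInst (.pair (encGraph G) (.pair (.num v) (.num k)))
      (encInst (G.restrict (G.nonNbrs v), k - 1)) (branchTime n) 0 := by
  have hlen : (encFinset (G.nonNbrs v)).toList.length ≤ n :=
    (length_toList_encFinset _).trans_le ((Finset.card_filter_le _ _).trans hn)
  refine (((((Run.fst _).pair (((Run.fst _).pair (Run.get 1 _)).comp
    (Run.nonNbrs G v hv hn))).comp (Run.induce G _ (G.nonNbrs v) (fun a => memVal_encFinset) hn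
      hlen)).pair (((Run.snd _).comp (Run.snd _)).comp (Run.pred _)))).cast rfl ?_ (by omega)
  unfold branchTime
  omega

theorem encGraph_restrict_empty (G : FGraph) : encGraph (G.restrict ∅) = .num 0 := by
  simp [encGraph, FGraph.restrict, encList]

theorem not_yes_empty (G : FGraph) : ¬Yes (G.restrict ∅, 1) := by
  rintro ⟨S, hS⟩
  obtain ⟨hS, -, hcard⟩ := isSolution_restrict.1 hS
  rw [Finset.inter_empty, Finset.subset_empty] at hS
  simp [hS] at hcard

theorem yes_zero (G : FGraph) : Yes (G, 0) :=
  ⟨∅, Finset.empty_subset _, by simp [SimpleGraph.isNIndepSet_iff]⟩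

theorem SolvesMIS.isPair (hω : SolvesMIS ω) (I : Inst) [Decidable (Yes I)] :
    (ω (encInst I)).isPair = encBool (decide (Yes I)) := by
  rcases hω I with ⟨S, hS, h⟩ | ⟨hno, h⟩
  · simp [h, Val.isPair, encBool, show Yes I from ⟨S, hS⟩]
  · simp [h, Val.isPair, encBool, hno]

/-- On input `(i, ((L, b), (G, k)))`: removes the first vertex `v` of `L`, and sets `b` if
`(G - N[v], k - 1)` is positive. If `L` is empty, asks a trivial question. -/
def Prog.branchStep : Prog :=
  .letp (.ite (.comp .isPair (.comp .fst (.get 1)))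
      (.comp .call (.comp .branchInst (.pair (.get 2) (.pair (.comp .fst (.comp .fst (.get 1)))
        (.get 3)))))
      (.comp .call (.pair (.const 0) (.const 1))))
    (.pair (.comp .snd (.comp .fst (.get 2)))
      (.ite (.comp .isPair (.get 0)) (.const 1) (.comp .snd (.get 2))))

def branchAcc (L : List ℕ) (b : Bool) : Val := .pair (numList L) (encBool b)

open Classical in
theorem Run.branchStep {G : FGraph} {L : List ℕ} {b : Bool} {i k n : ℕ}
    (hω : SolvesMIS ω) (hn : G.verts.card ≤ n) (hL : ∀ x ∈ L, x ∈ G.verts)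
    (hQ : ∀ U, Q (G.restrict U, k - 1)) (hQ' : Q (G.restrict ∅, 1)) :
    Run ω Q .branchStep (.pair (.num i) (.pair (branchAcc L b) (famEnv G k)))
      (branchAcc L.tail (b || decide (∃ v, L.head? = some v ∧
        Yes (G.restrict (G.nonNbrs v), k - 1)))) (branchTime n + 100) 1 := by
  set e := Val.pair (.num i) (.pair (branchAcc L b) (famEnv G k)) with he
  have hc : Run ω Q (.comp .isPair (.comp .fst (.get 1))) e (numList L).isPair _ _ :=
    ((Run.get 1 e).comp (Run.fst _)).comp (Run.isPair _)
  have hfin : ∀ r b', r.isPair = encBool b' → Run ω Q (.pair (.comp .snd (.comp .fst (.get 2)))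
      (.ite (.comp .isPair (.get 0)) (.const 1) (.comp .snd (.get 2)))) (.pair r e)
      (branchAcc L.tail (b || b')) 40 0 := by
    intro r b' hb'
    have h1 : Run ω Q (.comp .snd (.comp .fst (.get 2))) (.pair r e) (numList L).snd _ _ :=
      ((Run.get 2 _).comp (Run.fst _)).comp (Run.snd _)
    have h2 : Run ω Q (.comp .isPair (.get 0)) (.pair r e) (encBool b') _ _ :=
      ((Run.get 0 _).comp (Run.isPair _)).cast hb' le_rfl rfl
    have h3 : Run ω Q (.comp .snd (.get 2)) (.pair r e) (encBool b) _ _ :=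
      (Run.get 2 _).comp (Run.snd _)
    refine (h1.pair (h2.ite (fun _ => Run.const 1 _) (fun _ => h3))).cast ?_ (by omega) (by omega)
    congr 1
    · cases L <;> rfl
    · cases b' <;> cases b <;> rfl
  cases L with
  | nil =>
    have hq : Run ω Q (.comp .call (.pair (.const 0) (.const 1))) e
        (ω (encInst (G.restrict ∅, 1))) _ _ :=
      ((Run.const 0 e).pair (Run.const 1 e)).comp ((Run.call hQ').cast rfl le_rfl rfl |>
        fun h => by rwa [show encInst (G.restrict ∅, 1) = .pair (.num 0) (.num 1) by
          simp [encInst, encGraph_restrict_empty]] at h ⊢)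
    refine ((Run.ite_false hc hq).letp (hfin _ _ (hω.isPair _))).cast ?_ (by omega) (by omega)
    simp [not_yes_empty]
  | cons v L =>
    have hq : Run ω Q (.comp .call (.comp .branchInst (.pair (.get 2)
        (.pair (.comp .fst (.comp .fst (.get 1))) (.get 3))))) e
        (ω (encInst (G.restrict (G.nonNbrs v), k - 1))) _ _ :=
      (((Run.get 2 e).pair ((((Run.get 1 e).comp (Run.fst _)).comp (Run.fst _)).pair
        (Run.get 3 e))).comp (Run.branchInst G v k (hL v (by simp)) hn)).comp (Run.call (hQ _))
    refine ((Run.ite_true hc (by simp [numList, encList, Val.isPair]) hq).letp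
      (hfin _ _ (hω.isPair _))).cast ?_ (by omega) (by omega)
    simp

/-- There are `N` rounds whatever the length of the list; surplus rounds ask for a vertex in the
graph without vertices, and the negative answer leaves the disjunction unchanged. -/
theorem Run.branch {G : FGraph} {L₀ : List ℕ} {b₀ : Bool} {k n N : ℕ}
    (hω : SolvesMIS ω) (hn : G.verts.card ≤ n) (hL₀ : ∀ x ∈ L₀, x ∈ G.verts)
    (hN : L₀.length ≤ N) (hQ : ∀ U, Q (G.restrict U, k - 1)) (hQ' : Q (G.restrict ∅, 1)) :
    ∃ b, Run ω Q (.iter .branchStep) (.pair (.num N) (.pair (branchAcc L₀ b₀) (famEnv G k)))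
        (branchAcc [] b) (N * (branchTime n + 100 + 12) + 8) N ∧
      (b = true ↔ b₀ = true ∨ ∃ v ∈ L₀, Yes (G.restrict (G.nonNbrs v), k - 1)) := by
  classical
  let Inv : ℕ → Val → Prop := fun m v => ∃ L b, v = branchAcc L b ∧ (∀ x ∈ L, x ∈ G.verts) ∧
    L.length ≤ m ∧ ((b = true ∨ ∃ v ∈ L, Yes (G.restrict (G.nonNbrs v), k - 1)) ↔
      (b₀ = true ∨ ∃ v ∈ L₀, Yes (G.restrict (G.nonNbrs v), k - 1)))
  have hstep : ∀ m < N, ∀ v, Inv (m + 1) v → ∃ w, Inv m w ∧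
      Run ω Q .branchStep (.pair (.num (m + 1)) (.pair v (famEnv G k))) w
        (branchTime n + 100) 1 := by
    rintro m hm v ⟨L, b, rfl, hL, hlen, hb⟩
    refine ⟨_, ⟨L.tail, _, rfl, fun x hx => hL x (List.mem_of_mem_tail hx), ?_, ?_⟩,
      Run.branchStep hω hn hL hQ hQ'⟩
    · rw [List.length_tail]
      omega
    · rw [← hb]
      cases L <;> simp [or_assoc]
  obtain ⟨w, ⟨L, b, rfl, -, hlen, hb⟩, hr⟩ :=
    Run.iter Inv N hstep (branchAcc L₀ b₀) ⟨L₀, b₀, rfl, hL₀, hN, Iff.rfl⟩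
  obtain rfl : L = [] := List.length_eq_zero_iff.1 (by omega)
  exact ⟨b, hr.cast rfl le_rfl (by omega), by simpa using hb⟩

/-! ### FPT time bounds -/

/-- The bound `T(n, k)` is of the form `h(k) · n^O(1)` with a computable function `h`. -/
def IsFPTBound (T : ℕ → ℕ → ℕ) : Prop :=
  ∃ (h : ℕ → ℕ) (γ : ℕ), Computable h ∧ ∀ n k, T n k ≤ fptTime h γ n k

namespace IsFPTBound

variable {S T : ℕ → ℕ → ℕ}

theorem param {f : ℕ → ℕ} (hf : Computable f) : IsFPTBound fun _ k => f k :=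
  ⟨f, 0, hf, fun n k => by simp [fptTime]⟩

theorem const (c : ℕ) : IsFPTBound fun _ _ => c := param (.const c)

theorem size : IsFPTBound fun n _ => n :=
  ⟨fun _ => 1, 1, .const 1, fun n k => by simp [fptTime]⟩

theorem fptTime {f : ℕ → ℕ} (hf : Computable f) (γ : ℕ) : IsFPTBound (fptTime f γ) :=
  ⟨f, γ, hf, fun _ _ => le_rfl⟩

theorem add (hS : IsFPTBound S) (hT : IsFPTBound T) : IsFPTBound fun n k => S n k + T n k := by
  obtain ⟨h, γ, hh, hS⟩ := hS
  obtain ⟨h', γ', hh', hT⟩ := hT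
  refine ⟨fun k => h k + h' k, γ + γ', Primrec.nat_add.to_comp.comp hh hh', fun n k => ?_⟩
  refine (Nat.add_le_add (hS n k) (hT n k)).trans ?_
  simp only [MISReduction.fptTime, Nat.add_mul]
  exact Nat.add_le_add
    (Nat.mul_le_mul_left _ (Nat.pow_le_pow_right n.succ_pos (Nat.le_add_right _ _)))
    (Nat.mul_le_mul_left _ (Nat.pow_le_pow_right n.succ_pos (Nat.le_add_left _ _)))

theorem mul (hS : IsFPTBound S) (hT : IsFPTBound T) : IsFPTBound fun n k => S n k * T n k := by
  obtain ⟨h, γ, hh, hS⟩ := hS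
  obtain ⟨h', γ', hh', hT⟩ := hT
  refine ⟨fun k => h k * h' k, γ + γ', Primrec.nat_mul.to_comp.comp hh hh', fun n k => ?_⟩
  refine (Nat.mul_le_mul (hS n k) (hT n k)).trans_eq ?_
  simp only [MISReduction.fptTime, pow_add]
  ring

theorem memTime (hT : IsFPTBound T) : IsFPTBound fun n k => memTime (T n k) :=
  (hT.mul (const _)).add (const _)

theorem filterTime (hS : IsFPTBound S) (hT : IsFPTBound T) :
    IsFPTBound fun n k => filterTime (S n k) (T n k) :=
  (hS.mul (hT.memTime.add (const _))).add (const _)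

theorem induceTime : IsFPTBound fun n _ => induceTime n n :=
  (size.mul ((size.memTime.add (size.filterTime size)).add (const _))).add (const _)

theorem branchTime : IsFPTBound fun n _ => branchTime n :=
  (((size.mul (size.memTime.add (const _))).add (const _)).add induceTime).add (const _)

theorem famStepTime : IsFPTBound fun n _ => famStepTime n :=
  ((induceTime.add (size.filterTime size)).add (size.mul (const _))).add (const _)

theorem searchStepTime (hT : IsFPTBound T) : IsFPTBound fun n k => searchStepTime n (T n k) :=
  ((const _).mul (hT.mul (famStepTime.add (const _)))).add (const _)

end IsFPTBound

/-! ### Deciding instances by branching over all vertices -/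

theorem nonNbrs_card_le (G : FGraph) (S : Finset ℕ) : (G.restrict S).verts.card ≤ G.verts.card :=
  Finset.card_le_card Finset.inter_subset_left

/-- The decision procedure which calls the decision procedure `p` on all the instances
`(G - N[v], k - 1)`. -/
def Prog.decideByBranching (p : Prog) : Prog :=
  .ite .snd
    (.comp (.fold (.ite (.comp p (.comp .branchInst (.pair (.get 2) (.pair (.get 0) (.get 3)))))
        (.const 1) (.get 1)))
      (.pair (.comp .verts .fst) (.pair (.const 0) (.pair .fst (.pair .snd (.const 0))))))
    (.const 1)

/-- No connectedness is needed: for `k > 0` a solution contains some vertex `v`, and the rest of it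
solves `(G - N[v], k - 1)`. One call of the given procedure per vertex costs only a factor `n`. -/
theorem solvableInFPTTime_of_smallerInstances {𝓒 : Set Inst}
    (h : SolvableInFPTTime (smallerInstances 𝓒)) : SolvableInFPTTime 𝓒 := by
  classical
  obtain ⟨p, h, γ, hh, hp⟩ := h
  -- The calls have parameter `k - 1`, hence the shift in `h`.
  let T : ℕ → ℕ → ℕ := fun n k => n * (branchTime n + fptTime (fun k => h (k - 1)) γ n k + 100) +
    n * 60 + 200
  have hT : IsFPTBound T := ((IsFPTBound.size.mul ((IsFPTBound.branchTime.add (.fptTime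
    (hh.comp (Primrec.nat_sub.comp .id (.const 1)).to_comp) γ)).add (.const _))).add
      (IsFPTBound.size.mul (.const _))).add (.const _)
  obtain ⟨h', γ', hh', hT⟩ := hT
  refine ⟨.decideByBranching p, h', γ', hh', fun I hI => ?_⟩
  obtain ⟨G, k⟩ := I
  suffices Run (fun v => v) (fun _ => True) (.decideByBranching p) (encInst (G, k))
      (encBool (decide (Yes (G, k)))) (T G.verts.card k) 0 by
    obtain ⟨t, ht, hc⟩ := this.computes
    exact ⟨t, ht.trans (hT _ _), by convert hc⟩
  cases k with
  | zero =>
    exact (Run.ite_false (Run.snd _) (Run.const 1 _)).cast (by simp [yes_zero, encBool])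
      (by simp only [T]; omega) rfl
  | succ k =>
    have hans : ∀ v ∈ G.verts, Run (fun v => v) (fun _ => True) p
        (encInst (G.restrict (G.nonNbrs v), k))
        (encBool (decide (Yes (G.restrict (G.nonNbrs v), k))))
        (fptTime (fun k => h (k - 1)) γ G.verts.card (k + 1)) 0 := by
      intro v hv
      obtain ⟨t, ht, hc⟩ := hp (G.restrict (G.nonNbrs v), k)
        ⟨_, hI, G.restrict_isInducedSubgraph _, Nat.lt_succ_self k⟩
      refine Run.of_computes (t := t) (by convert hc) (ht.trans (Nat.mul_le_mul_left _
        (Nat.pow_le_pow_left (Nat.succ_le_succ (nonNbrs_card_le _ _)) _)))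
    have hfold := Run.fold (ω := fun v => v) (Q := fun _ => True) encBool
      (fun b x => b || match x with
        | .num v => decide (Yes (G.restrict (G.nonNbrs v), k))
        | _ => false) (ρ := famEnv G (k + 1)) (encFinset G.verts)
      (T := branchTime G.verts.card + fptTime (fun k => h (k - 1)) γ G.verts.card (k + 1) + 60)
      (m := 0) (body := .ite (.comp p (.comp .branchInst (.pair (.get 2) (.pair (.get 0)
        (.get 3))))) (.const 1) (.get 1)) ?_ false
    · refine (Run.ite_true (Run.snd _) (by simp [encInst, Val.snd])
        (((((Run.fst _).comp (Run.verts G le_rfl)).pair ((Run.const 0 _).pair ((Run.fst _).pair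
          ((Run.snd _).pair (Run.const 0 _))))).comp hfold))).cast ?_ ?_ (by omega)
      · congr 1
        rw [Bool.eq_iff_iff, decide_eq_true_eq, encFinset_eq, toList_numList, List.foldl_map]
        have : ∀ (l : List ℕ) (b : Bool), l.foldl (fun b v => b ||
            decide (Yes (G.restrict (G.nonNbrs v), k))) b = true ↔
            b = true ∨ ∃ v ∈ l, Yes (G.restrict (G.nonNbrs v), k) := by
          intro l
          induction l with
          | nil => simp
          | cons a l ih =>
            intro b
            rw [List.foldl_cons, ih]
            simp [or_assoc]
        rw [this]
        constructor
        · rintro (h | ⟨v, hv, h⟩)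
          · simp at h
          · exact yes_of_yes_nonNbrs (by simpa using hv) h
        · rintro ⟨S, hS⟩
          obtain ⟨v, hv⟩ : S.Nonempty := by
            rw [← Finset.card_pos, hS.2.2]
            exact Nat.succ_pos _
          exact Or.inr ⟨v, by simpa using hS.1 hv, yes_nonNbrs_of_isSolution hS hv⟩
      · rw [length_toList_encFinset]
        simp only [T, Nat.mul_add]
        omega
    · intro x hx b
      obtain ⟨v, hv, rfl⟩ := List.mem_map.1 (toList_numList _ ▸ (encFinset_eq G.verts ▸ hx))
      have hvG : v ∈ G.verts := by simpa using hv
      have hc : Run (fun v => v) (fun _ => True) (.comp p (.comp .branchInst (.pair (.get 2)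
          (.pair (.get 0) (.get 3))))) (.pair (.num v) (.pair (encBool b) (famEnv G (k + 1))))
          _ _ _ :=
        (((Run.get 2 _).pair ((Run.get 0 _).pair (Run.get 3 _))).comp
          (Run.branchInst G v (k + 1) hvG le_rfl)).comp (hans v hvG)
      refine (hc.ite (fun _ => Run.const 1 _) (fun _ => Run.get 1 _)).cast ?_ (by omega) (by omega)
      change _ = encBool (b || decide (Yes (G.restrict (G.nonNbrs v), k)))
      generalize decide (Yes (G.restrict (G.nonNbrs v), k)) = y
      cases b <;> cases y <;> rfl

/-! ### Thresholds -/

/-- The number of disjoint independent sets the reduction looks for. -/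
def threshold (g d : ℕ → ℕ) (k : ℕ) : ℕ := g k + d k * (k * k + 1) ^ (d k * (k * k) + 1) + 1

/-- The number of vertices the reduction branches over. -/
def branchNumber (g d : ℕ → ℕ) (k : ℕ) : ℕ := threshold g d k + (k - 1) * (threshold g d k * k)

/-- The number of instances the reduction produces. -/
def questionNumber (g d : ℕ → ℕ) (k : ℕ) : ℕ :=
  if k < 2 then 0
  else (k - 1) * (threshold g d k + threshold g d k) + branchNumber g d k + 1

theorem computable_threshold {g d : ℕ → ℕ} (hg : Computable g) (hd : Computable d) :
    Computable (threshold g d) := by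
  have hpow : Primrec₂ ((· ^ ·) : ℕ → ℕ → ℕ) := Primrec₂.unpaired'.1 Nat.Primrec.pow
  have hk : Computable fun k : ℕ => k * k := (Primrec.nat_mul.comp .id .id).to_comp
  exact Primrec.nat_add.to_comp.comp (Primrec.nat_add.to_comp.comp hg
    (Primrec.nat_mul.to_comp.comp hd (hpow.to_comp.comp
      (Primrec.nat_add.to_comp.comp hk (.const 1))
      (Primrec.nat_add.to_comp.comp (Primrec.nat_mul.to_comp.comp hd hk) (.const 1))))) (.const 1)

theorem computable_pred : Computable fun k : ℕ => k - 1 :=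
  (Primrec.nat_sub.comp .id (.const 1)).to_comp

theorem computable_branchNumber {g d : ℕ → ℕ} (hg : Computable g) (hd : Computable d) :
    Computable (branchNumber g d) :=
  Primrec.nat_add.to_comp.comp (computable_threshold hg hd) (Primrec.nat_mul.to_comp.comp
    computable_pred (Primrec.nat_mul.to_comp.comp (computable_threshold hg hd) .id))

theorem computable_questionNumber {g d : ℕ → ℕ} (hg : Computable g) (hd : Computable d) :
    Computable (questionNumber g d) := by
  have hP := computable_threshold hg hd
  have h2 : Computable fun k => decide (k < 2) :=
    (Primrec.nat_lt.decide.comp .id (.const 2)).to_comp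
  refine (Computable.cond h2 (.const 0) (Primrec.nat_add.to_comp.comp
    (Primrec.nat_add.to_comp.comp (Primrec.nat_mul.to_comp.comp computable_pred
      (Primrec.nat_add.to_comp.comp hP hP)) (computable_branchNumber hg hd)) (.const 1))).of_eq
    fun k => ?_
  by_cases h : k < 2 <;> simp [questionNumber, h]

theorem threshold_pos (g d : ℕ → ℕ) (k : ℕ) : 0 < threshold g d k := Nat.succ_pos _

theorem mul_le_sq {i j k : ℕ} (hij : i + j = k) : i * j ≤ k * k :=
  Nat.mul_le_mul (by omega) (by omega)

/-- Both base and exponent are controlled by `i * j ≤ k * k`; the `+ 1` in the base of `threshold`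
makes the power monotone in the exponent even for `k = 0`. The summand `g k` of `threshold` has
another purpose: it makes `threshold g d k < R.card` impossible for a witness. -/
theorem pow_lt_threshold (g d : ℕ → ℕ) {i j k : ℕ} (hij : i + j = k) :
    (d k - 1) * (i * j) ^ ((d k - 1) * (i * j) + 1) < threshold g d k := by
  have h : (d k - 1) * (i * j) ^ ((d k - 1) * (i * j) + 1) ≤
      d k * (k * k + 1) ^ (d k * (k * k) + 1) := by
    refine Nat.mul_le_mul (Nat.sub_le _ _) ((Nat.pow_le_pow_left
      ((mul_le_sq hij).trans (Nat.le_succ _)) _).trans (Nat.pow_le_pow_right (Nat.succ_pos _) ?_))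
    exact Nat.succ_le_succ (Nat.mul_le_mul (Nat.sub_le _ _) (mul_le_sq hij))
  unfold threshold
  omega

theorem mul_lt_threshold (g d : ℕ → ℕ) {i j k : ℕ} (hij : i + j = k) :
    (d k - 1) * (i * j) + 1 ≤ threshold g d k := by
  have h : (d k - 1) * (i * j) ≤ d k * (k * k + 1) ^ (d k * (k * k) + 1) :=
    Nat.mul_le_mul (Nat.sub_le _ _) (((mul_le_sq hij).trans (Nat.le_succ _)).trans
      (Nat.le_self_pow (Nat.succ_ne_zero _) _))
  unfold threshold
  omega

/-- One of the two families must be large, but for the other `(d k - 1) * (i * j) + 1` sets suffice.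
A side of size 1 supplies that many singletons, so for `i = 1` the roles of `A` and `B` are
exchanged. -/
theorem IsWitness.yes {g d : ℕ → ℕ} {G : FGraph} {k : ℕ} {A B R : Finset ℕ}
    (hw : IsWitness g d G k A B R) (h : SearchSucceeds G A B (threshold g d k) k) :
    Yes (G, k) := by
  obtain ⟨i, j, hi, hj, hij, hAi, hBj⟩ := h
  have hsub : A ∪ B ∪ R = G.verts := hw.tripartition.union_eq
  have hA : A ⊆ G.verts := by
    rw [← hsub]
    exact Finset.subset_union_left.trans Finset.subset_union_left
  have hB : B ⊆ G.verts := by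
    rw [← hsub]
    exact Finset.subset_union_right.trans Finset.subset_union_left
  have hAB := hw.tripartition.disjoint_AB
  have hfree := bicliqueFree_of_free hAB hw.biclique_free
  have hd := hfree.pos
  -- Of the lower bounds on `A` and `B` only this consequence is needed: with a part 1 the product
  -- `i * j` is `k - 1`.
  have hbig : (d k - 1) * (k - 1) + 1 ≤ d k ^ d k * k ^ (2 * d k - 1) + 1 :=
    Nat.succ_le_succ (Nat.mul_le_mul ((Nat.sub_le _ _).trans (Nat.le_self_pow (by omega) _))
      ((Nat.sub_le _ _).trans (Nat.le_self_pow (by omega) _)))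
  have hA' : (d k - 1) * (k - 1) + 1 ≤ A.card := hbig.trans hw.lt_card_A.le
  have hB' : (d k - 1) * (k - 1) + 1 ≤ B.card := hbig.trans hw.lt_card_B.le
  rcases hAi with hAi | rfl
  · have hY : HasFamily G B j ((d k - 1) * (i * j) + 1) := by
      rcases hBj with hBj | rfl
      · exact hBj.mono (mul_lt_threshold g d hij)
      · refine hasFamily_one G ?_
        rwa [Nat.mul_one, show i = k - 1 by omega]
    have := yes_of_hasFamily hAB hA hB hfree hAi hY (pow_lt_threshold g d hij)
    rwa [hij] at this
  · rcases hBj with hBj | rfl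
    · have hji : j + 1 = k := by omega
      have hX : HasFamily G A 1 ((d k - 1) * (j * 1) + 1) := by
        refine hasFamily_one G ?_
        rwa [Nat.mul_one, show j = k - 1 by omega]
      have := yes_of_hasFamily hAB.symm hB hA hfree.symm hBj hX (pow_lt_threshold g d hji)
      rwa [hji] at this
    -- For `k = 2` both sides consist of singletons; there is a single colour, so `d` vertices on
    -- each side suffice.
    · subst hij
      refine yes_of_hasFamily hAB hA hB hfree (p := d (1 + 1)) (hasFamily_one G ?_)
        (hasFamily_one G ?_) ?_
      · simp only [Nat.add_sub_cancel, Nat.mul_one] at hA'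
        omega
      · simpa using hB'
      · simp only [Nat.mul_one, Nat.one_pow]
        omega

/-! ### Preparations for the main program -/

theorem depth_encList_le {l : List Val} {M : ℕ} (h : ∀ x ∈ l, x.depth ≤ M) :
    (encList l).depth ≤ l.length + M := by
  induction l with
  | nil => simp [encList, Val.depth]
  | cons a l ih =>
    have h1 := h a (by simp)
    have h2 := ih fun x hx => h x (by simp [hx])
    simp only [encList, Val.depth, List.length_cons]
    omega

theorem depth_encFinset_le (S : Finset ℕ) : (encFinset S).depth ≤ S.card := by
  refine (depth_encList_le (M := 0) fun x hx => ?_).trans (by simp)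
  obtain ⟨a, -, rfl⟩ := List.mem_map.1 hx
  exact le_rfl

theorem depth_encInst_le (I : Inst) : (encInst I).depth ≤ 2 * I.1.verts.card + 2 := by
  have h : (encGraph I.1).depth ≤ I.1.verts.card + (I.1.verts.card + 1) := by
    refine (depth_encList_le (M := I.1.verts.card + 1) fun x hx => ?_).trans (by simp)
    obtain ⟨a, -, rfl⟩ := List.mem_map.1 hx
    have h1 := depth_encFinset_le (@Finset.filter ℕ (fun u => I.1.graph.Adj a u)
      (fun _ => Classical.propDecidable _) I.1.verts)
    have h2 := Finset.card_le_card (@Finset.filter_subset ℕ (fun u => I.1.graph.Adj a u)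
      (fun _ => Classical.propDecidable _) I.1.verts)
    simp only [Val.depth]
    omega
  simp only [encInst, Val.depth]
  omega

/-- The machine has no comparison of sizes. Whether a list has more than `P` entries is seen by
dropping `P` of them and testing for emptiness. -/
theorem Run.drop (l : List ℕ) (P : ℕ) (ρ : Val) :
    Run ω Q (.iter (.comp .snd (.get 1))) (.pair (.num P) (.pair (numList l) ρ))
      (numList (l.drop P)) (P * 20 + 8) 0 := by
  let Inv : ℕ → Val → Prop := fun i v => i ≤ P ∧ v = numList (l.drop (P - i))
  have hstep : ∀ i < P, ∀ v, Inv (i + 1) v → ∃ w, Inv i w ∧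
      Run ω Q (.comp .snd (.get 1)) (.pair (.num (i + 1)) (.pair v ρ)) w 8 0 := by
    rintro i hi v ⟨-, rfl⟩
    refine ⟨_, ⟨hi.le, rfl⟩, ((Run.get 1 _).comp (Run.snd _)).cast ?_ (by omega) rfl⟩
    rw [show P - i = P - (i + 1) + 1 by omega, ← List.tail_drop]
    change (numList (l.drop (P - (i + 1)))).snd = _
    cases l.drop (P - (i + 1)) <;> rfl
  obtain ⟨w, ⟨-, rfl⟩, hr⟩ := Run.iter Inv P hstep (numList l) ⟨le_rfl, by simp⟩
  exact hr.cast rfl (by omega) (by omega)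

theorem isPair_numList (l : List ℕ) : (numList l).isPair = encBool (decide (l ≠ [])) := by
  cases l <;> rfl

/-! ### The main program -/

/-- The reduction up to the last question: decides whether `(G, k)` is positive, for `k ≥ 2`.
The program `p` finds witnesses, `pP` and `pN` compute the threshold and the branch number. -/
def Prog.reduce (p pP pN : Prog) : Prog :=
  .comp
    (.letp (.comp .verts (.get 1))
    (.letp (.comp .inter (.pair (.get 0) (.comp .fst (.get 1))))
    (.letp (.comp .inter (.pair (.get 1) (.comp .fst (.comp .snd (.get 2)))))
    (.letp (.comp .diff (.pair (.comp .diff (.pair (.get 2) (.get 1))) (.get 0)))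
    (.letp (.comp pP (.get 6))
    (.letp (.comp .isPair (.comp (.iter (.comp .snd (.get 1)))
      (.pair (.get 0) (.pair (.get 1) (.const 0)))))
    (.letp (.ite (.get 0) (.const 0) (.get 2))
    (.letp (.comp (.iter .searchStep) (.pair (.comp .pred (.get 9))
      (.pair (.pair (.const 1) (.pair (.get 0) (.get 1)))
        (.pair (.get 8) (.pair (.get 5) (.pair (.get 4) (.pair (.get 2) (.const 0))))))))
    (.comp .snd (.comp (.iter .branchStep) (.pair (.comp pN (.get 10))
      (.pair (.comp .snd (.get 0)) (.pair (.get 9) (.pair (.get 10) (.const 0)))))))))))))))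
    (.pair p (.pair .fst (.pair .snd (.const 0))))

def reduceTime (h TP TN P N : ℕ → ℕ) (γ n k : ℕ) : ℕ :=
  fptTime h γ n k + n * 60 + 2 * filterTime n (2 * n + 2 + fptTime h γ n k) +
    2 * filterTime n n + TP k + P k * 20 + (k - 1) * (searchStepTime n (P k) + 12) + TN k +
    N k * (branchTime n + 100 + 12) + 1000

theorem isFPTBound_reduceTime {h TP TN P N : ℕ → ℕ} (hh : Computable h) (hTP : Computable TP)
    (hTN : Computable TN) (hP : Computable P) (hN : Computable N) (γ : ℕ) :
    IsFPTBound (reduceTime h TP TN P N γ) := by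
  unfold reduceTime
  have hf := IsFPTBound.fptTime hh γ
  have h1 := IsFPTBound.size.filterTime
    (((IsFPTBound.const 2).mul .size).add (.const 2) |>.add hf)
  have h2 := IsFPTBound.size.filterTime IsFPTBound.size
  exact ((((((((hf.add (IsFPTBound.size.mul (.const _))).add ((IsFPTBound.const 2).mul h1)).add
    ((IsFPTBound.const 2).mul h2)).add (.param hTP)).add ((IsFPTBound.param hP).mul
    (.const _))).add ((IsFPTBound.param computable_pred).mul
      ((IsFPTBound.searchStepTime (.param hP)).add (.const _)))).add (.param hTN)).add
    ((IsFPTBound.param hN).mul ((IsFPTBound.branchTime.add (.const _)).add (.const _)))).add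
    (.const _)

/-- The sanitising of the output, which makes the three sets cover the vertices in any case, does
not alter a genuine witness. -/
theorem IsWitness.eq_filter {g d : ℕ → ℕ} {k : ℕ} {G : FGraph} {A B R : Finset ℕ}
    (hw : IsWitness g d G k A B R) :
    (G.verts.filter fun a => memVal a (encFinset A) = true) = A ∧
      (G.verts.filter fun a => memVal a (encFinset B) = true) = B ∧ (G.verts \ A) \ B = R := by
  have hunion := hw.tripartition.union_eq
  refine ⟨?_, ?_, ?_⟩
  · ext a
    rw [Finset.mem_filter, ← hunion, memVal_encFinset]
    simp only [Finset.mem_union]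
    tauto
  · ext a
    rw [Finset.mem_filter, ← hunion, memVal_encFinset]
    simp only [Finset.mem_union]
    tauto
  · ext a
    have h1 : a ∈ A → a ∉ R := fun h => Finset.disjoint_left.1 hw.tripartition.disjoint_AR h
    have h2 : a ∈ B → a ∉ R := fun h => Finset.disjoint_left.1 hw.tripartition.disjoint_BR h
    rw [← hunion]
    simp only [Finset.mem_sdiff, Finset.mem_union]
    tauto

/-- Soundness: if `(G, k)` is negative then `α(G) ≤ k`, so the witness is genuine, and it excludes
both a large remainder and a successful search. Completeness does not use the witness, not even
disjointness of `A` and `B`: a solution avoiding `L` lies in `A ∪ B` and has at least `k` vertices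
counted over the two sides, so it contradicts `hcomp` for a suitable split. -/
theorem yes_iff_of_search {g d : ℕ → ℕ} {k : ℕ} {G : FGraph} {A B : Finset ℕ} {L : List ℕ}
    {big b₁ : Bool} (hk : 2 ≤ k)
    (hw : G.alpha ≤ k → IsWitness g d G k A B ((G.verts \ A) \ B))
    (hbig : big = true ↔ threshold g d k < ((G.verts \ A) \ B).card)
    (hRL : big = false → ∀ x ∈ (G.verts \ A) \ B, x ∈ L) (hLV : ∀ x ∈ L, x ∈ G.verts)
    (hsound : b₁ = true → big = true ∨ SearchSucceeds G A B (threshold g d k) k)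
    (hb₁ : big = true → b₁ = true)
    (hcomp : ∀ i j, 0 < i → 0 < j → i + j = k → b₁ = true ∨
      (i ≠ 1 ∧ ∀ T ⊆ A, G.graph.IsNIndepSet i T → ∃ x ∈ T, x ∈ L) ∨
      (j ≠ 1 ∧ ∀ T ⊆ B, G.graph.IsNIndepSet j T → ∃ x ∈ T, x ∈ L)) :
    (b₁ = true ∨ ∃ v ∈ L, Yes (G.restrict (G.nonNbrs v), k - 1)) ↔ Yes (G, k) := by
  have hk1 : k - 1 + 1 = k := by omega
  constructor
  · rintro (h | ⟨v, hv, h⟩)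
    · by_contra hno
      have hwit := hw (le_of_not_gt fun hlt => hno (yes_of_le_alpha hlt.le))
      rcases hsound h with h | h
      · have h1 := hbig.1 h
        have h2 := hwit.card_R_le
        unfold threshold at h1
        omega
      · exact hno (hwit.yes h)
    · have := yes_of_yes_nonNbrs (hLV v hv) h
      rwa [hk1] at this
  · rintro ⟨S, hS⟩
    by_contra! hcon
    obtain ⟨hb₁f, hL⟩ := hcon
    have hSL : ∀ x ∈ S, x ∉ L := fun x hx hxL =>
      hL x hxL (yes_nonNbrs_of_isSolution (by rwa [hk1]) hx)
    have hbigf : big = false := Bool.eq_false_iff.2 fun h => hb₁f (hb₁ h)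
    have hSAB : S ⊆ A ∪ B := by
      intro x hx
      by_contra hxAB
      simp only [Finset.mem_union, not_or] at hxAB
      exact hSL x hx (hRL hbigf x (Finset.mem_sdiff.2 ⟨Finset.mem_sdiff.2 ⟨hS.1 hx, hxAB.1⟩,
        hxAB.2⟩))
    have hcard : k ≤ (S ∩ A).card + (S ∩ B).card := by
      have h1 : S.card = k := hS.2.2
      have h2 := Finset.card_union_le (S ∩ A) (S ∩ B)
      rw [← Finset.inter_union_distrib_left, Finset.inter_eq_left.2 hSAB] at h2
      omega
    have hno : ∀ X s, s ≤ (S ∩ X).card →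
        ¬∀ T ⊆ X, G.graph.IsNIndepSet s T → ∃ x ∈ T, x ∈ L := by
      intro X s hs hX
      obtain ⟨T, hT, hTi⟩ := exists_subset_isNIndepSet
        (hS.2.1.mono (Finset.coe_subset.2 (Finset.inter_subset_left (s₂ := X)))) hs
      obtain ⟨x, hx, hxL⟩ := hX T (hT.trans Finset.inter_subset_right) hTi
      exact hSL x (Finset.inter_subset_left (hT hx)) hxL
    have hsplit : ∀ i j, 0 < i → 0 < j → i + j = k → (i = 1 ∨ i ≤ (S ∩ A).card) →
        (j = 1 ∨ j ≤ (S ∩ B).card) → False := by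
      intro i j hi hj hij hiA hjB
      rcases hcomp i j hi hj hij with h | ⟨h1, h⟩ | ⟨h1, h⟩
      · exact hb₁f h
      · exact hno A i (hiA.resolve_left h1) h
      · exact hno B j (hjB.resolve_left h1) h
    -- Both parts must be positive: a solution missing `B` is treated by `(k - 1, 1)`, and the
    -- maximum yields `(1, k - 1)` for one missing `A`. A part 1 need not be realised by `S`, since
    -- it is never the failing side.
    rcases Nat.eq_zero_or_pos (S ∩ B).card with h | h
    · exact hsplit (k - 1) 1 (by omega) (by omega) (by omega) (by omega) (by omega)
    · exact hsplit (max 1 (k - (S ∩ B).card)) (k - max 1 (k - (S ∩ B).card)) (by omega)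
        (by omega) (by omega) (by omega) (by omega)

theorem Run.reduce {g d h TP TN : ℕ → ℕ} {γ k t : ℕ} {p pP pN : Prog} {G : FGraph} {w : Val}
    (hω : SolvesMIS ω) (hk : 2 ≤ k) (hQ : ∀ U, ∀ s < k, Q (G.restrict U, s))
    (hP : ∀ ω Q n, Run ω Q pP (.num n) (.num (threshold g d n)) (TP n) 0)
    (hN : ∀ ω Q n, Run ω Q pN (.num n) (.num (branchNumber g d n)) (TN n) 0)
    (ht : t ≤ fptTime h γ G.verts.card k) (hp : Computes p (encInst (G, k)) w t)
    (hw : G.alpha ≤ k → ∃ A B R, IsWitness g d G k A B R ∧ w = encTriple A B R) :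
    ∃ b, Run ω Q (.reduce p pP pN) (encInst (G, k)) (encBool b)
        (reduceTime h TP TN (threshold g d) (branchNumber g d) γ G.verts.card k)
        ((k - 1) * (threshold g d k + threshold g d k) + branchNumber g d k) ∧
      (b = true ↔ Yes (G, k)) := by
  obtain ⟨n, hn⟩ : ∃ n, G.verts.card = n := ⟨_, rfl⟩
  obtain ⟨P, hPk⟩ : ∃ P, threshold g d k = P := ⟨_, rfl⟩
  obtain ⟨D, hD⟩ : ∃ D, 2 * n + 2 + fptTime h γ n k = D := ⟨_, rfl⟩
  rw [hn] at ht
  -- Bounds the lengths of the lists read off from `w`, also when `w` is not a witness.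
  have hwD : w.depth ≤ D := by
    have h1 := hp.depth_le
    have h2 := depth_encInst_le (G, k)
    simp only [hn] at h2
    omega
  obtain ⟨A, hA⟩ : ∃ A, (G.verts.filter fun a => memVal a w.fst = true) = A := ⟨_, rfl⟩
  obtain ⟨B, hB⟩ : ∃ B, (G.verts.filter fun a => memVal a w.snd.fst = true) = B := ⟨_, rfl⟩
  obtain ⟨R, hR⟩ : ∃ R, (G.verts \ A) \ B = R := ⟨_, rfl⟩
  have hAV : A ⊆ G.verts := hA ▸ Finset.filter_subset _ _
  have hBV : B ⊆ G.verts := hB ▸ Finset.filter_subset _ _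
  have hRV : R ⊆ G.verts := hR ▸ Finset.sdiff_subset.trans Finset.sdiff_subset
  obtain ⟨big, hbig⟩ : ∃ big, decide ((R.sort (· ≤ ·)).drop P ≠ []) = big := ⟨_, rfl⟩
  have hbig' : big = true ↔ P < R.card := by
    rw [← hbig, decide_eq_true_eq, ne_eq, List.drop_eq_nil_iff, Finset.length_sort, not_le]
  -- If `R` has more than `P` vertices, the verdict is already positive and `R` can be left out; so
  -- `L₀` never exceeds `P` entries.
  obtain ⟨L₀, hL₀⟩ : ∃ L₀ : List ℕ, (if big = true then [] else R.sort (· ≤ ·)) = L₀ := ⟨_, rfl⟩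
  have hL₀V : ∀ x ∈ L₀, x ∈ G.verts := by
    intro x hx
    rw [← hL₀] at hx
    split at hx
    · simp at hx
    · exact hRV (by simpa using hx)
  have hL₀P : L₀.length ≤ P := by
    rw [← hL₀]
    split
    · simp
    · rename_i h
      rw [hbig', not_lt] at h
      simpa using h
  have hP0 : 0 < P := hPk ▸ threshold_pos g d k
  obtain ⟨L, b₁, hr₁, hL₀L, hLV, hlen, hsound, hb₁, hcomp⟩ :=
    Run.search (Q := Q) (b₀ := big) (P := P) hω hn.le hAV hBV hL₀V hP0 hQ
  have hLN : L.length ≤ branchNumber g d k := by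
    unfold branchNumber
    rw [hPk]
    omega
  obtain ⟨b, hr₂, hb⟩ := Run.branch (Q := Q) (b₀ := b₁) (N := branchNumber g d k) hω hn.le hLV hLN
    (fun U => hQ U (k - 1) (by omega)) (hQ ∅ 1 (by omega))
  refine ⟨b, ?_, hb.trans (yes_iff_of_search hk (fun hα => ?_) (by rw [hR, hPk]; exact hbig')
    (fun hf x hx => hL₀L x ?_) hLV (by rwa [hPk]) hb₁ hcomp)⟩
  rotate_left
  · obtain ⟨A', B', R', hwit, rfl⟩ := hw hα
    obtain ⟨h1, h2, h3⟩ := hwit.eq_filter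
    obtain rfl : A' = A := h1.symm.trans hA
    obtain rfl : B' = B := h2.symm.trans hB
    rwa [h3]
  · rw [← hL₀, if_neg (by simp [hf])]
    simpa [hR] using hx
  rw [hPk, hn]
  set e := Val.pair w (.pair (encGraph G) (.pair (.num k) (.num 0))) with he
  have h0 : Run ω Q (.pair p (.pair .fst (.pair .snd (.const 0)))) (encInst (G, k)) e _ _ :=
    (Run.of_computes hp ht).pair ((Run.fst _).pair ((Run.snd _).pair (Run.const 0 _)))
  have h1 : Run ω Q (.comp .verts (.get 1)) e (encFinset G.verts) _ _ :=
    (Run.get 1 e).comp (Run.verts G hn.le)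
  set e1 := Val.pair (encFinset G.verts) e with he1
  have h2 : Run ω Q (.comp .inter (.pair (.get 0) (.comp .fst (.get 1)))) e1 (encFinset A) _ _ :=
    ((Run.get 0 e1).pair ((Run.get 1 e1).comp (Run.fst _))).comp
      ((Run.inter_encFinset G.verts w.fst hn.le ((length_toList_le_depth _).trans
        ((depth_fst_le _).trans hwD))).cast (congrArg _ hA) le_rfl rfl)
  set e2 := Val.pair (encFinset A) e1 with he2
  have h3 : Run ω Q (.comp .inter (.pair (.get 1) (.comp .fst (.comp .snd (.get 2))))) e2
      (encFinset B) _ _ :=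
    ((Run.get 1 e2).pair (((Run.get 2 e2).comp (Run.snd _)).comp (Run.fst _))).comp
      ((Run.inter_encFinset G.verts w.snd.fst hn.le ((length_toList_le_depth _).trans
        ((depth_fst_le _).trans ((depth_snd_le _).trans hwD)))).cast (congrArg _ hB) le_rfl rfl)
  set e3 := Val.pair (encFinset B) e2 with he3
  have h4 : Run ω Q (.comp .diff (.pair (.comp .diff (.pair (.get 2) (.get 1))) (.get 0))) e3
      (encFinset R) _ _ :=
    ((((Run.get 2 e3).pair (Run.get 1 e3)).comp (Run.diff_encFinset G.verts A hn.le
      ((Finset.card_le_card hAV).trans hn.le))).pair (Run.get 0 e3)).comp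
      ((Run.diff_encFinset (G.verts \ A) B ((Finset.card_le_card Finset.sdiff_subset).trans hn.le)
        ((Finset.card_le_card hBV).trans hn.le)).cast (congrArg _ hR) le_rfl rfl)
  set e4 := Val.pair (encFinset R) e3 with he4
  have h5 : Run ω Q (.comp pP (.get 6)) e4 (.num P) _ _ := (Run.get 6 e4).comp
    ((hP ω Q k).cast (congrArg _ hPk) le_rfl rfl)
  set e5 := Val.pair (.num P) e4 with he5
  have h6 : Run ω Q (.comp .isPair (.comp (.iter (.comp .snd (.get 1)))
      (.pair (.get 0) (.pair (.get 1) (.const 0))))) e5 (encBool big) _ _ :=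
    (((Run.get 0 e5).pair ((Run.get 1 e5).pair (Run.const 0 e5))).comp
      (Run.drop (R.sort (· ≤ ·)) P _)).comp
      ((Run.isPair _).cast ((isPair_numList _).trans (congrArg _ hbig)) le_rfl rfl)
  set e6 := Val.pair (encBool big) e5 with he6
  have h7 : Run ω Q (.ite (.get 0) (.const 0) (.get 2)) e6 (numList L₀) 20 0 := by
    have hc : Run ω Q (.get 0) e6 (encBool big) _ _ := Run.get 0 e6
    refine (hc.ite (fun _ => Run.const 0 e6) (fun _ => Run.get 2 e6)).cast ?_ (by omega)
      (by omega)
    rw [← hL₀]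
    split <;> rfl
  set e7 := Val.pair (numList L₀) e6 with he7
  have h8 : Run ω Q (.comp (.iter .searchStep) (.pair (.comp .pred (.get 9))
      (.pair (.pair (.const 1) (.pair (.get 0) (.get 1)))
        (.pair (.get 8) (.pair (.get 5) (.pair (.get 4) (.pair (.get 2) (.const 0)))))))) e7
      (searchAcc (k - 1 + 1) L b₁) _ _ :=
    ((((Run.get 9 e7).comp (Run.pred _))).pair (((Run.const 1 e7).pair ((Run.get 0 e7).pair
      (Run.get 1 e7))).pair ((Run.get 8 e7).pair ((Run.get 5 e7).pair ((Run.get 4 e7).pair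
        ((Run.get 2 e7).pair (Run.const 0 e7))))))).comp hr₁
  set e8 := Val.pair (searchAcc (k - 1 + 1) L b₁) e7 with he8
  have h9 : Run ω Q (.comp .snd (.comp (.iter .branchStep) (.pair (.comp pN (.get 10))
      (.pair (.comp .snd (.get 0)) (.pair (.get 9) (.pair (.get 10) (.const 0))))))) e8
      (encBool b) _ _ :=
    (((((Run.get 10 e8).comp (hN ω Q k)).pair (((Run.get 0 e8).comp (Run.snd _)).pair
      ((Run.get 9 e8).pair ((Run.get 10 e8).pair (Run.const 0 e8))))).comp hr₂)).comp (Run.snd _)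
  refine (h0.comp (h1.letp (h2.letp (h3.letp (h4.letp (h5.letp (h6.letp (h7.letp
    (h8.letp h9))))))))).cast rfl ?_ (by omega)
  clear * - ht hPk hD
  unfold reduceTime
  rw [hD, hPk]
  omega

/-! ### The theorem -/

/-- The last answer, by which the reduction decides. -/
def lastAnswer (bs : List Bool) : Bool := bs.foldl (fun _ b => b) true

theorem fptCheckable_lastAnswer : FPTCheckable lastAnswer := by
  refine ⟨.comp (.fold (.get 0)) (.pair .id (.pair (.const 1) (.const 0))), fun _ => 50, 1,
    .const 50, fun bs => ?_⟩
  have h := Run.fold (ω := fun v => v) (Q := fun _ => True) (fun v => v) (fun _ v => v)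
    (ρ := .num 0) (encList (bs.map encBool)) (fun x _ b => Run.get 0 _) (.num 1)
  have hr := ((Run.id (ω := fun v => v) (Q := fun _ => True) (encList (bs.map encBool))).pair
    ((Run.const 1 _).pair (Run.const 0 _))).comp h
  refine (hr.cast (w' := encBool (lastAnswer bs)) (T' := fptTime (fun _ => 50) 1 bs.length
    bs.length) (m' := 0) ?_ ?_ (by omega)).computes
  · rw [toList_encList, List.foldl_map, lastAnswer]
    change bs.foldl (fun _ b => encBool b) (encBool true) = _
    clear h hr
    generalize true = b
    induction bs generalizing b with
    | nil => rfl
    | cons a bs ih => exact ih a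
  · simp only [toList_encList, List.length_map, fptTime, pow_one]
    omega

/-- The last question of the reduction, on input of the answer `b`: the graph without vertices and
the parameter `0` if `b` is true, and the parameter `1` otherwise. -/
def Prog.lastQuestion : Prog := .pair (.const 0) (.ite .id (.const 0) (.const 1))

theorem computes_lastQuestion (G : FGraph) (b : Bool) :
    ∃ t ≤ 10, Computes .lastQuestion (encBool b) (encInst (G.restrict ∅, if b then 0 else 1)) t := by
  refine Run.computes (ω := fun v => v) (Q := fun _ => True) (((Run.const 0 _).pair
    ((Run.id _).ite (fun _ => Run.const 0 _) (fun _ => Run.const 1 _))).cast ?_ (by omega)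
      (by omega))
  rw [encInst, encGraph_restrict_empty]
  cases b <;> rfl

/-- The set `A` of a witness is nonempty, so `α(G) ≥ 1` whenever a witness exists. These parameters
need separate treatment because the trivial negative question has parameter `1`, which must be below
`k`. -/
theorem WeaklyConnected.yes_of_lt_two {g d : ℕ → ℕ} {𝓒 : Set Inst} (h : WeaklyConnected g d 𝓒)
    {I : Inst} (hI : I ∈ 𝓒) (hk : I.2 < 2) : Yes I := by
  rcases Nat.lt_or_ge I.2 I.1.alpha with hlt | hge
  · exact yes_of_le_alpha hlt.le
  · obtain ⟨A, B, R, hw⟩ := h.2.2 I hI hge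
    refine yes_of_le_alpha (k := I.2) ?_
    obtain ⟨a, ha⟩ := hw.tripartition.nonempty_A
    have haV : a ∈ I.1.verts := by
      rw [← hw.tripartition.union_eq]
      simp [ha]
    have : 1 ≤ I.1.alpha := by
      have := SimpleGraph.IsIndepSet.card_le_indepNum
        (G := I.1.graph.induce (I.1.verts : Set ℕ)) (t := {⟨a, haV⟩}) (by simp)
      simpa [FGraph.alpha] using this
    omega

/-- A single list of questions serves all the required properties. The question appended to those of
`Prog.reduce` turns its verdict into an oracle answer and accounts for the `+ 1` in
`questionNumber`. -/
theorem exists_reduction {g d h : ℕ → ℕ} {γ : ℕ} {𝓒 : Set Inst} {p : Prog}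
    (hweak : WeaklyConnected g d 𝓒) (hh : Computable h) (hp : FindsWitness g d 𝓒 p h γ) :
    ∃ (q : Prog) (h' : ℕ → ℕ) (γ' : ℕ), Computable h' ∧ ∀ I ∈ 𝓒, ∀ ω, SolvesMIS ω →
      ∃ (Js : List Inst) (t : ℕ), Produces ω q I Js t ∧ t ≤ fptTime h' γ' I.1.verts.card I.2 ∧
        Js.length = questionNumber g d I.2 ∧
        (∀ J ∈ Js, J.1.IsInducedSubgraph I.1 ∧ J.2 < I.2) ∧
        (Yes I ↔ lastAnswer (Js.map fun J => @decide (Yes J) (Classical.dec _)) = true) := by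
  classical
  obtain ⟨pP, TP, hTP, hpP⟩ := exists_prog_of_computable (computable_threshold hweak.1 hweak.2.1)
  obtain ⟨pN, TN, hTN, hpN⟩ :=
    exists_prog_of_computable (computable_branchNumber hweak.1 hweak.2.1)
  obtain ⟨h', γ', hh', hT⟩ := (isFPTBound_reduceTime hh hTP hTN
    (computable_threshold hweak.1 hweak.2.1) (computable_branchNumber hweak.1 hweak.2.1) γ).add
    (.const 30)
  -- The truncated difference `k - 1` is nonzero exactly for `k ≥ 2`.
  refine ⟨.ite (.comp .pred .snd) (.comp (.comp .call .lastQuestion) (.reduce p pP pN)) (.const 1),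
    h', γ', hh', fun I hI ω hω => ?_⟩
  rcases Nat.lt_or_ge I.2 2 with hk | hk
  · have hc : Eval ω (.comp .pred .snd) (encInst I) (.num 0) 3 [] := by
      have := Eval.comp (.snd (ω := ω) (encInst I)) (.pred _)
      rwa [show (encInst I).snd.pred = .num 0 by
        simp only [encInst, Val.snd, Val.pred, Val.num.injEq]
        omega] at this
    refine ⟨[], 5, ⟨_, hc.ite_false (.const 1 _)⟩, ?_, ?_, by simp, ?_⟩
    · exact le_trans (Nat.le_add_left_of_le (by omega)) (hT _ _)
    · simp [questionNumber, hk]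
    -- No question has been asked, and the default value of `lastAnswer` on the empty list is
    -- `true`, the correct verdict.
    · simp [lastAnswer, hweak.yes_of_lt_two hI hk]
  · obtain ⟨G, k⟩ := I
    obtain ⟨w, t, ht, hpc, hw⟩ := hp _ hI
    let Q : Inst → Prop := fun J => J.1.IsInducedSubgraph G ∧ J.2 < k
    obtain ⟨b, ⟨t₁, Js, ht₁, hlen, hJs, hev⟩, hb⟩ := Run.reduce (Q := Q) hω hk
      (fun U s hs => ⟨G.restrict_isInducedSubgraph U, hs⟩) hpP hpN ht hpc hw
    obtain ⟨t₂, ht₂, hlast⟩ := computes_lastQuestion G b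
    have hc : Eval ω (.comp .pred .snd) (encInst (G, k)) (.num (k - 1)) 3 [] :=
      .comp (.snd _) (.pred _)
    have hev' := hc.ite_true (g := .const 1) (by simp; omega) (.comp hev (.comp (hlast ω) (.call _)))
    have hprod : Produces ω _ (G, k) (Js ++ [(G.restrict ∅, if b then 0 else 1)]) _ :=
      ⟨_, by rw [List.map_append]; exact hev'⟩
    refine ⟨_, _, hprod, ?_, ?_, ?_, ?_⟩
    · have := hT G.verts.card k
      dsimp only at this ht₁ ⊢
      omega
    · rw [List.length_append, hlen]
      exact (if_neg (not_lt.2 hk)).symm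
    · intro J hJ
      rcases List.mem_append.1 hJ with hJ | hJ
      · exact hJs J hJ
      · rw [List.mem_singleton.1 hJ]
        refine ⟨G.restrict_isInducedSubgraph ∅, ?_⟩
        simp only
        split <;> omega
    · rw [← hb, lastAnswer, List.map_append, List.foldl_append]
      cases b
      · simp [not_yes_empty]
      · simp [yes_zero]

end MISReduction

end

theorem mainTheorem4 (g d h : ℕ → ℕ) (γ : ℕ) (𝓒 : Set MISReduction.Inst)
    (hweak : MISReduction.WeaklyConnected g d 𝓒)
    (hh : Computable h)
    (hfind : ∃ p : MISReduction.Prog, MISReduction.FindsWitness g d 𝓒 p h γ) :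
    (∃ (g' : ℕ → ℕ) (q : MISReduction.Prog),
      MISReduction.IsDecreasingFPTTuringReduction 𝓒 g' q ∧
        MISReduction.ProducesInducedSubgraphs 𝓒 q) ∧
    (MISReduction.SolvableInFPTTime (MISReduction.smallerInstances 𝓒) →
      MISReduction.SolvableInFPTTime 𝓒) := by
  obtain ⟨p, hp⟩ := hfind
  obtain ⟨q, h', γ', hh', hq⟩ := MISReduction.exists_reduction hweak hh hp
  refine ⟨⟨MISReduction.questionNumber g d, q, ⟨MISReduction.computable_questionNumber hweak.1
    hweak.2.1, MISReduction.lastAnswer, h', γ', MISReduction.fptCheckable_lastAnswer, hh',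
    fun I hI ω hω => ?_⟩, fun I hI ω hω => ?_⟩,
    MISReduction.solvableInFPTTime_of_smallerInstances⟩
  · obtain ⟨Js, t, h1, h2, h3, h4, h5⟩ := hq I hI ω hω
    exact ⟨Js, t, h1, h2, h3, h5, fun J hJ => Finset.card_le_card (h4 J hJ).1.1,
      fun J hJ => (h4 J hJ).2⟩
  · obtain ⟨Js, t, h1, -, -, h4, -⟩ := hq I hI ω hω
    exact ⟨Js, t, h1, fun J hJ => (h4 J hJ).1⟩
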